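/- Let $S$ be a closed flat surface of genus $g\ge 2$. That is, $S$ is a closed oriented surface of genus $g$ with a length metric $d$ and a finite set $\Sigma\subset S$ such that: $S\setminus\Sigma$ is covered by charts into $\mathbb{C}$ which are local isometries and whose transition maps are locally of the form $z\mapsto \pm z+c$; and every point of $\Sigma$ has a neighbourhood isometric to a neighbourhood of the tip of a Euclidean cone of total angle $k\pi$, for some integer $k\ge 3$. Let $\pi:\tilde S\to S$ be the universal cover with the lifted length metric $d$, let $\Gamma$ be its group of deck transformations, and for $\tilde q\in\tilde S$ put $$N_{\tilde q}(R)=\#\{\tilde x\in \Gamma\tilde q : d(\tilde q,\tilde x)\le R\},\qquad e(S)=\limsup_{R\to\infty}\frac{\log N_{\tilde q}(R)}{R}.$$ The number $e(S)$, which does not depend on $\tilde q$, is the volume entropy of $S$. Let $\alpha,\beta:[0,1]\to S$ be closed curves of finite lengths $a=\ell(\alpha)$ and $b=\ell(\beta)$ with $a\le b$, based at a common point $p=\alpha(0)=\alpha(1)=\beta(0)=\beta(1)$. If the subgroup $\langle\alpha,\beta\rangle$ of $\pi_1(S,p)$ is neither cyclic nor trivial, then $$e(S)\ \ge\ \max\left\{\frac{\log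 b-\log a}{2b},\ \frac{\log 2}{b}\right\}.$$ -/

import Mathlib

open Set Filter Topology
open scoped unitInterval ENNReal

noncomputable section

/-! ### Closed oriented surfaces of genus `g` -/

/-- The point of the unit circle with arc parameter `s`, the circle being divided into
`4 * g` sides of parameter length one (side number `k` is `k ≤ s ≤ k + 1`). -/
def polygonBoundaryPoint (g : ℕ) (s : ℝ) : Metric.closedBall (0 : ℂ) 1 :=
  ⟨Complex.exp (((2 * Real.pi * s / (4 * (g : ℝ)) : ℝ) : ℂ) * Complex.I), by
    rw [mem_closedBall_zero_iff, Complex.norm_exp_ofReal_mul_I]⟩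

/-- The identification of the sides of the `4 * g`-gon according to the word
`a₁ b₁ a₁⁻¹ b₁⁻¹ ⋯ a_g b_g a_g⁻¹ b_g⁻¹`. -/
inductive PolygonGluing (g : ℕ) :
    Metric.closedBall (0 : ℂ) 1 → Metric.closedBall (0 : ℂ) 1 → Prop
  | a_side (j : ℕ) (hj : j < g) (t : ℝ) (ht : t ∈ Icc (0 : ℝ) 1) :
      PolygonGluing g (polygonBoundaryPoint g (4 * j + t)) (polygonBoundaryPoint g (4 * j + 3 - t))
  | b_side (j : ℕ) (hj : j < g) (t : ℝ) (ht : t ∈ Icc (0 : ℝ) 1) :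
      PolygonGluing g (polygonBoundaryPoint g (4 * j + 1 + t))
        (polygonBoundaryPoint g (4 * j + 4 - t))

/-- The closed oriented surface of genus `g ≥ 1`: the `4 * g`-gon with its sides identified in
pairs, with the quotient topology (by the equivalence relation generated by the gluing). -/
abbrev GenusSurface (g : ℕ) : Type := Quot (PolygonGluing g)

/-- `X` is a closed (connected, oriented) surface of genus `g ≥ 1`. -/
def IsClosedSurfaceOfGenus (X : Type*) [TopologicalSpace X] (g : ℕ) : Prop :=
  Nonempty (X ≃ₜ GenusSurface g)

/-! ### Length of curves -/

/-- The length of a curve in a metric space: the supremum of the lengths of inscribed polygons. -/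
def curveLength {X : Type*} [PseudoEMetricSpace X] {x y : X} (γ : Path x y) : ℝ≥0∞ :=
  eVariationOn (fun t : I => γ t) univ

/-! ### Flat surfaces -/

/-- The distance, in the Euclidean cone of total angle `θ`, between the points with polar
coordinates `(r, t)` and `(s, u)`; the norm on `ℝ / θℤ` is the angular distance. -/
def coneDist (θ : ℝ) (r : ℝ) (t : AddCircle θ) (s : ℝ) (u : AddCircle θ) : ℝ :=
  Real.sqrt (r ^ 2 + s ^ 2 - 2 * r * s * Real.cos (min Real.pi ‖t - u‖))

/-- The metric space `X` has a cone point of total angle `θ` at `x`: some ball around `x` is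
isometric to a ball around the tip of the Euclidean cone of total angle `θ`. -/
def IsConePoint {X : Type*} [MetricSpace X] (θ : ℝ) (x : X) : Prop :=
  ∃ R > 0, ∃ P : ℝ → AddCircle θ → X,
    (∀ t, P 0 t = x) ∧
    (∀ y ∈ Metric.ball x R, ∃ r ∈ Ico 0 R, ∃ t, P r t = y) ∧
    ∀ r ∈ Ico 0 R, ∀ s ∈ Ico 0 R, ∀ t u, dist (P r t) (P s u) = coneDist θ r t s u

/-- A flat structure on `X`, for which the given metric of `X` is the flat metric: a finite set of
singularities, a half-translation atlas on its complement, and the metric of `X` is the length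
metric which in each chart is the Euclidean metric and which has at every singularity a cone angle
`k π` with an integer `k ≥ 3`. -/
structure FlatSurface (X : Type*) [MetricSpace X] where
  /-- The singularities. -/
  sing : Set X
  finite_sing : sing.Finite
  /-- The charts, defined on open subsets of the complement of the singularities. -/
  charts : Set (OpenPartialHomeomorph X ℂ)
  disjoint_sing : ∀ φ ∈ charts, Disjoint φ.source sing
  cover : ∀ x, x ∉ sing → ∃ φ ∈ charts, x ∈ φ.source
  /-- Changes of charts are locally of the form `z ↦ ± z + c`. -/
  half_translation : ∀ φ ∈ charts, ∀ ψ ∈ charts, ∀ x ∈ φ.source ∩ ψ.source,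
    ∃ ε : ℂ, (ε = 1 ∨ ε = -1) ∧ ∃ c : ℂ, ∀ᶠ y in 𝓝 x, ψ y = ε * φ y + c
  /-- The charts are local isometries. -/
  local_isometry : ∀ φ ∈ charts, ∀ x ∈ φ.source, ∃ r > 0, Metric.ball x r ⊆ φ.source ∧
    ∀ y ∈ Metric.ball x r, ∀ z ∈ Metric.ball x r, dist (φ y) (φ z) = dist y z
  cone_angle : ∀ x ∈ sing, ∃ k : ℕ, 3 ≤ k ∧ IsConePoint ((k : ℝ) * Real.pi) x
  /-- The metric is the length metric. -/
  length_metric : ∀ x y : X, edist x y = ⨅ γ : Path x y, curveLength γ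

/-! ### The universal cover and the volume entropy -/

section Length

variable {X : Type*} [PseudoEMetricSpace X] {x y z : X}

theorem curveLength_refl (x : X) : curveLength (Path.refl x) = 0 :=
  eVariationOn.constant_on (by
    rintro _ ⟨_, _, rfl⟩ _ ⟨_, _, rfl⟩
    rfl)

theorem curveLength_symm_le (γ : Path x y) : curveLength γ.symm ≤ curveLength γ :=
  eVariationOn.comp_le_of_antitoneOn (fun t : I => γ t) unitInterval.symm
    (fun _ _ _ _ h => unitInterval.symm_le_symm.2 h) (fun _ _ => mem_univ _)

theorem curveLength_symm (γ : Path x y) : curveLength γ.symm = curveLength γ :=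
  le_antisymm (curveLength_symm_le γ) (by simpa using curveLength_symm_le γ.symm)

theorem curveLength_trans_le (γ : Path x y) (δ : Path y z) :
    curveLength (γ.trans δ) ≤ curveLength γ + curveLength δ := by
  have hm : (⟨1 / 2, by norm_num, by norm_num⟩ : I) ∈ (univ : Set I) := mem_univ _
  set m : I := ⟨1 / 2, by norm_num, by norm_num⟩ with hmdef
  have hsplit : eVariationOn (fun t : I => γ.trans δ t) univ =
      eVariationOn (fun t : I => γ.trans δ t) (Iic m) +
        eVariationOn (fun t : I => γ.trans δ t) (Ici m) := by
    rw [← eVariationOn.union _ (isGreatest_Iic : IsGreatest (Iic m) m) isLeast_Ici, Iic_union_Ici]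
  unfold curveLength
  rw [hsplit]
  refine add_le_add ?_ ?_
  · let p : I → I := fun t => projIcc 0 1 zero_le_one (2 * (t : ℝ))
    have hp : EqOn (fun t : I => γ.trans δ t) ((fun t : I => γ t) ∘ p) (Iic m) := by
      intro t ht
      have ht' : (t : ℝ) ≤ 1 / 2 := ht
      simp only [Path.trans_apply, ht', dif_pos, Function.comp, p]
      congr 1
      rw [projIcc_of_mem]
    rw [eVariationOn.congr hp]
    refine eVariationOn.comp_le_of_monotoneOn _ p ?_ (fun _ _ => mem_univ _)
    intro s _ t _ hst
    have hst' : (s : ℝ) ≤ t := hst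
    exact monotone_projIcc _ (by linarith)
  · let p : I → I := fun t => projIcc 0 1 zero_le_one (2 * (t : ℝ) - 1)
    have hp : EqOn (fun t : I => γ.trans δ t) ((fun t : I => δ t) ∘ p) (Ici m) := by
      intro t ht
      have ht' : 1 / 2 ≤ (t : ℝ) := ht
      simp only [Path.trans_apply, Function.comp, p]
      split_ifs with h
      · have h2 : (t : ℝ) = 1 / 2 := le_antisymm h ht'
        have e1 : (⟨2 * (t : ℝ), by rw [h2]; norm_num, by rw [h2]; norm_num⟩ : I) = 1 :=
          Subtype.ext (by simp [h2])
        have e2 : projIcc (0 : ℝ) 1 zero_le_one (2 * (t : ℝ) - 1) = 0 :=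
          projIcc_of_le_left _ (by rw [h2]; norm_num)
        rw [e1, e2, γ.target, δ.source]
      · congr 1
        rw [projIcc_of_mem]
    rw [eVariationOn.congr hp]
    refine eVariationOn.comp_le_of_monotoneOn _ p ?_ (fun _ _ => mem_univ _)
    intro s _ t _ hst
    have hst' : (s : ℝ) ≤ t := hst
    exact monotone_projIcc _ (by linarith)

/-- The infimum of the lengths of the curves in a homotopy class (with fixed endpoints). -/
def classLength (c : Path.Homotopic.Quotient x y) : ℝ≥0∞ :=
  ⨅ (γ : Path x y) (_ : Path.Homotopic.Quotient.mk γ = c), curveLength γ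

theorem classLength_mk_le (γ : Path x y) :
    classLength (Path.Homotopic.Quotient.mk γ) ≤ curveLength γ :=
  iInf_le_of_le γ (iInf_le_of_le rfl le_rfl)

theorem classLength_refl (x : X) : classLength (Path.Homotopic.Quotient.refl x) = 0 :=
  le_antisymm ((classLength_mk_le (Path.refl x)).trans (curveLength_refl x).le) bot_le

theorem classLength_symm_le (c : Path.Homotopic.Quotient x y) :
    classLength c.symm ≤ classLength c := by
  refine le_iInf₂ fun γ hγ => ?_
  subst hγ
  rw [← Path.Homotopic.Quotient.mk_symm]
  exact (classLength_mk_le _).trans (curveLength_symm_le γ)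

theorem classLength_trans_le (c : Path.Homotopic.Quotient x y) (d : Path.Homotopic.Quotient y z) :
    classLength (c.trans d) ≤ classLength c + classLength d := by
  conv_rhs => unfold classLength
  simp only [ENNReal.iInf_add, ENNReal.add_iInf]
  refine le_iInf₂ fun δ hδ => le_iInf₂ fun γ hγ => ?_
  subst hγ
  subst hδ
  exact (classLength_mk_le (γ.trans δ)).trans (curveLength_trans_le γ δ)

end Length

/-- The universal cover of `X`, as the set of homotopy classes of paths issuing from `x₀`. -/
structure UniversalCover {X : Type*} [TopologicalSpace X] (x₀ : X) where
  /-- The covering projection. -/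
  proj : X
  /-- The homotopy class of paths. -/
  cls : Path.Homotopic.Quotient x₀ proj

namespace UniversalCover

variable {X : Type*} [PseudoEMetricSpace X] {x₀ : X}

/-- The flat (lifted length) metric of the universal cover: the distance between the classes of
`γ` and `δ` is the infimum of the lengths of the curves in `X` homotopic to `γ⁻¹ δ`; these are the
projections of the curves in the cover which join the two points. -/
instance : PseudoEMetricSpace (UniversalCover x₀) where
  edist p q := classLength (p.cls.symm.trans q.cls)
  edist_self p := by
    have h : p.cls.symm.trans p.cls = Path.Homotopic.Quotient.refl p.proj := by
      simp
    change classLength (p.cls.symm.trans p.cls) = 0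
    rw [h, classLength_refl]
  edist_comm p q := by
    have key : ∀ p q : UniversalCover x₀,
        classLength (p.cls.symm.trans q.cls) ≤ classLength (q.cls.symm.trans p.cls) := by
      intro p q
      have h : p.cls.symm.trans q.cls = (q.cls.symm.trans p.cls).symm := by
        obtain ⟨x, a⟩ := p
        obtain ⟨y, b⟩ := q
        induction a with | mk a =>
        induction b with | mk b =>
        simp only [← Path.Homotopic.Quotient.mk_symm, ← Path.Homotopic.Quotient.mk_trans,
          Path.trans_symm, Path.symm_symm]
      rw [h]
      exact classLength_symm_le _
    exact le_antisymm (key p q) (key q p)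
  edist_triangle p q r := by
    have h : p.cls.symm.trans r.cls =
        (p.cls.symm.trans q.cls).trans (q.cls.symm.trans r.cls) := by
      rw [Path.Homotopic.Quotient.trans_assoc, ← Path.Homotopic.Quotient.trans_assoc q.cls]
      simp
    change classLength (p.cls.symm.trans r.cls) ≤ _
    rw [h]
    exact classLength_trans_le _ _

/-- A deck transformation: a homeomorphism of the universal cover over the base. -/
def IsDeckTransformation (f : UniversalCover x₀ ≃ₜ UniversalCover x₀) : Prop :=
  ∀ z, (f z).proj = z.proj

/-- The orbit of a point under the group of deck transformations. -/
def deckOrbit (p : UniversalCover x₀) : Set (UniversalCover x₀) :=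
  {q | ∃ f : UniversalCover x₀ ≃ₜ UniversalCover x₀, IsDeckTransformation f ∧ f p = q}

/-- The number of points of the orbit of `p` at distance at most `R` from `p`. -/
def orbitCount (p : UniversalCover x₀) (R : ℝ) : ℕ∞ :=
  {q ∈ deckOrbit p | edist p q ≤ ENNReal.ofReal R}.encard

/-- The volume entropy `limsup_{R → ∞} log N(R) / R`, computed from the point `p` of the
universal cover, as an extended real number. -/
def volumeEntropy (p : UniversalCover x₀) : EReal :=
  limsup (fun R : ℝ => ENNReal.log ((orbitCount p R : ℕ∞) : ℝ≥0∞) / (R : EReal)) atTop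

end UniversalCover

end

/-!
The entropy is bounded below by the growth rate of a free semigroup of deck transformations.

**Growth.** Suppose that two loops of lengths `a ≤ b` freely generate a free semigroup. The images
of a point of the universal cover under the elements of this semigroup are distinct, and up to a
constant they are displaced by at most the length of the corresponding word. The number of words
of length at most `R` satisfies `N R ≥ N (R - a) + N (R - b)`, so that it grows at a rate of at
least `h` for every `h` with `e^{-ha} + e^{-hb} ≥ 1` (`exists_finset_wordLength_le`,
`UniversalCover.le_volumeEntropy`). Both terms of the maximum satisfy this inequality.

**Free semigroups in surface groups.** It remains to be seen that two elements of the fundamental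
group `P` of a closed surface of genus `g ≥ 2` lie in a cyclic subgroup or freely generate a free
semigroup (`IsSurfaceGroup.mem_zpowers_or_wordEval_injective`). For elements of a free group, this
follows from the Nielsen–Schreier theorem and a count of the homomorphisms to a finite group
(`IsFreeGroup.mem_zpowers_or_wordEval_injective`). As the homomorphisms from `P` to `ℤ` form a group
of rank `2g ≥ 4`, some nonzero homomorphism `φ` kills both elements. They belong to the fundamental
group of an infinite cyclic cover, which is a free group because the cover is a noncompact surface.
The algebraic form of this argument is a homomorphism `Λ` from `P` to the wreath product `F ≀ ℤ`,
`F` being the free group on the edges of the cover: `Λ` reads off the translation `φ ξ` of an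
element `ξ` and, for each integer `n`, a word in the edges which represents the lift of `ξ` starting
at level `n`. Such a `Λ` exists because the relation of `P` can be solved for the lift of one
generator, the equations being a recursion over `ℤ` (`IsSurfaceGroup.exists_hom_wreath`). On the
kernel of `φ`, the label at `0` is an injective homomorphism to `F`.

**The fundamental group of the glued polygon.** The argument above uses generators of `P` and the
existence of homomorphisms to torsion-free groups with prescribed values on them
(`IsSurfaceGroup`). A loop in the surface can be followed by a point of the polygon which
jumps between identified points, hence `P` is generated by the transition loops of these jumps
(`eq_top_of_transition_mem`); the local contractibility required here is supplied by the flat metric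
(`FlatSurface.exists_nhds_homotopic`). Conversely, let `G` be a
torsion-free group with elements that satisfy the relation. Then `G` acts freely and properly
discontinuously on the space of nonzero finitely supported functions on `G`, and the polygon can be
mapped to this space by sending its vertices to multiples of the partial products of the relation,
compatibly with the gluing (`polygonChain`). The induced map from the surface to the orbit space
yields the homomorphism (`exists_hom_of_equivariant`, `isSurfaceGroup_of_polygon`).
-/

noncomputable section

/-! ### Positive words in free groups -/

/-- The element of a monoid spelled by a word in two letters, `true` standing for `x` and `false`
for `y`. -/
def wordEval {M : Type*} [Monoid M] (x y : M) (w : List Bool) : M :=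
  (w.map fun b => cond b x y).prod

section Words

variable {M N : Type*} [Monoid M] [Monoid N]

@[simp] theorem wordEval_nil (x y : M) : wordEval x y [] = 1 := rfl

@[simp] theorem wordEval_cons (x y : M) (b : Bool) (w : List Bool) :
    wordEval x y (b :: w) = cond b x y * wordEval x y w := by
  simp [wordEval]

theorem map_wordEval (f : M →* N) (x y : M) (w : List Bool) :
    f (wordEval x y w) = wordEval (f x) (f y) w := by
  induction w with
  | nil => simp
  | cons b w ih => cases b <;> simp [ih]

end Words

/-- The number with binary digits `w`, the first letter being the last digit, preceded by a leading
digit `1`. -/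
def binaryCode : List Bool → ℕ
  | [] => 1
  | b :: w => 2 * binaryCode w + b.toNat

theorem binaryCode_pos (w : List Bool) : 0 < binaryCode w := by
  induction w with
  | nil => simp [binaryCode]
  | cons b w ih => simp only [binaryCode]; omega

theorem binaryCode_injective : Function.Injective binaryCode := by
  intro w
  induction w with
  | nil =>
    rintro (_ | ⟨b, w'⟩) h
    · rfl
    · have := binaryCode_pos w'
      simp only [binaryCode] at h
      omega
  | cons b w ih =>
    rintro (_ | ⟨b', w'⟩) h
    · have := binaryCode_pos w
      simp only [binaryCode] at h
      omega
    · simp only [binaryCode] at h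
      have hb : b = b' := by
        cases b <;> cases b' <;> simp at h ⊢ <;> omega
      subst hb
      rw [ih (show binaryCode w = binaryCode w' by omega)]

/-- Distinct positive words are separated by a pair of elements of a finite group: the words are
evaluated at the affine maps `z ↦ 2 z + 1` and `z ↦ 2 z` modulo a large odd number. -/
theorem exists_finite_wordEval_ne {w₁ w₂ : List Bool} (h : w₁ ≠ w₂) :
    ∃ (Q : Type) (_ : Group Q) (_ : Finite Q) (x y : Q), wordEval x y w₁ ≠ wordEval x y w₂ := by
  set N : ℕ := 2 * (binaryCode w₁ + binaryCode w₂) + 1 with hN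
  have : NeZero N := ⟨by omega⟩
  have h2 : IsUnit (2 : ZMod N) := by
    have : ((2 : ℕ) : ZMod N) = 2 := by norm_cast
    rw [← this, ZMod.isUnit_iff_coprime]
    rw [hN]
    simp
  obtain ⟨u, hu⟩ := h2
  let y : Equiv.Perm (ZMod N) := Units.mulLeft u
  let x : Equiv.Perm (ZMod N) := y.trans (Equiv.addRight 1)
  have key : ∀ w, wordEval x y w 1 = (binaryCode w : ZMod N) := by
    intro w
    induction w with
    | nil => simp [binaryCode]
    | cons b w ih =>
      rw [wordEval_cons, Equiv.Perm.mul_apply, ih]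
      cases b <;> simp [x, y, hu, binaryCode]
  refine ⟨Equiv.Perm (ZMod N), inferInstance, inferInstance, x, y, fun he => h ?_⟩
  apply binaryCode_injective
  have h1 := key w₁
  rw [he, key w₂] at h1
  have h3 := (ZMod.natCast_eq_natCast_iff' _ _ _).1 h1
  rw [Nat.mod_eq_of_lt (by omega), Nat.mod_eq_of_lt (by omega)] at h3
  exact h3.symm

/-- Two generators of a free group either lie in a cyclic subgroup or freely generate a free
semigroup. In the second case the group has two basis elements, so that it has at least as many
homomorphisms to a finite group `Q` as there are pairs in `Q`; these homomorphisms are determined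
by the images of the two generators, which can thus be prescribed. -/
theorem IsFreeGroup.mem_zpowers_or_wordEval_injective {H : Type*} [Group H] [IsFreeGroup H]
    {x y : H} (hxy : Subgroup.closure {x, y} = ⊤) :
    (∃ c : H, x ∈ Subgroup.zpowers c ∧ y ∈ Subgroup.zpowers c) ∨
      Function.Injective (wordEval x y) := by
  classical
  by_cases hs : Subsingleton (IsFreeGroup.Generators H)
  · left
    have hcl : ∃ c : FreeGroup (IsFreeGroup.Generators H), ∀ z, z ∈ Subgroup.zpowers c := by
      rcases isEmpty_or_nonempty (IsFreeGroup.Generators H) with he | ⟨⟨i⟩⟩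
      · exact ⟨1, fun z => by rw [Subsingleton.elim z 1]; exact one_mem _⟩
      · refine ⟨FreeGroup.of i, fun z => ?_⟩
        have hr : Set.range (FreeGroup.of : IsFreeGroup.Generators H → _) = {FreeGroup.of i} := by
          ext w
          simp only [mem_range, mem_singleton_iff]
          exact ⟨fun ⟨j, hj⟩ => by rw [← hj, Subsingleton.elim j i], fun h => ⟨i, h.symm⟩⟩
        rw [Subgroup.zpowers_eq_closure, ← hr, FreeGroup.closure_range_of]
        trivial
    obtain ⟨c, hc⟩ := hcl
    have : ∀ z : H, z ∈ Subgroup.zpowers (IsFreeGroup.mulEquiv H c) := by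
      intro z
      obtain ⟨k, hk⟩ := hc ((IsFreeGroup.mulEquiv H).symm z)
      refine ⟨k, ?_⟩
      have := congrArg (IsFreeGroup.mulEquiv H) hk
      simpa using this
    exact ⟨_, this x, this y⟩
  · right
    obtain ⟨i, j, hij⟩ := not_subsingleton_iff_nontrivial.1 hs
    intro w₁ w₂ hw
    by_contra hne
    obtain ⟨Q, _, _, X, Y, hXY⟩ := exists_finite_wordEval_ne hne
    -- Both `Θ` and `ev` are injective, so that `ev ∘ Θ` is a permutation of the finite set `Q × Q`.
    let Θ : Q × Q → (H →* Q) := fun p =>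
      IsFreeGroup.lift fun k => if k = i then p.1 else if k = j then p.2 else 1
    let ev : (H →* Q) → Q × Q := fun f => (f x, f y)
    have hΘ : Function.Injective Θ := by
      rintro ⟨p, r⟩ ⟨p', r'⟩ h
      have h' := IsFreeGroup.lift.injective h
      have h1 := congrFun h' i
      have h2 := congrFun h' j
      simp only [if_true, if_neg hij.symm] at h1 h2
      rw [h1, h2]
    have hev : Function.Injective ev := by
      intro f f' h
      have h1 : f x = f' x := congrArg Prod.fst h
      have h2 : f y = f' y := congrArg Prod.snd h
      refine MonoidHom.eq_of_eqOn_top ?_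
      rw [← hxy]
      refine MonoidHom.eqOn_closure ?_
      rintro z (rfl | rfl)
      · exact h1
      · exact h2
    obtain ⟨p, hp⟩ := Finite.injective_iff_surjective.1 (hev.comp hΘ) (X, Y)
    have h1 : Θ p x = X := congrArg Prod.fst hp
    have h2 : Θ p y = Y := congrArg Prod.snd hp
    apply hXY
    rw [← h1, ← h2, ← map_wordEval, ← map_wordEval, hw]

theorem FreeGroup.mem_zpowers_or_wordEval_injective {J : Type*} (x y : FreeGroup J) :
    (∃ c, x ∈ Subgroup.zpowers c ∧ y ∈ Subgroup.zpowers c) ∨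
      Function.Injective (wordEval x y) := by
  set H := Subgroup.closure {x, y} with hH
  have hx : x ∈ H := Subgroup.subset_closure (by simp)
  have hy : y ∈ H := Subgroup.subset_closure (by simp)
  have hcl : Subgroup.closure {(⟨x, hx⟩ : H), ⟨y, hy⟩} = ⊤ := by
    have h := Subgroup.closure_closure_coe_preimage (k := ({x, y} : Set (FreeGroup J)))
    rw [← h]
    congr 1
    ext z
    simp [Subtype.ext_iff]
  rcases IsFreeGroup.mem_zpowers_or_wordEval_injective hcl with ⟨c, ⟨k, hk⟩, ⟨l, hl⟩⟩ | h
  · refine Or.inl ⟨c, ⟨k, ?_⟩, ⟨l, ?_⟩⟩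
    · simpa using congrArg Subtype.val hk
    · simpa using congrArg Subtype.val hl
  · refine Or.inr fun w₁ w₂ hw => h (Subtype.ext ?_)
    have e : ∀ w, ((wordEval (⟨x, hx⟩ : H) ⟨y, hy⟩ w : H) : FreeGroup J) = wordEval x y w :=
      fun w => map_wordEval H.subtype _ _ w
    rw [e, e, hw]

/-! ### The wreath product of a group with the integers -/

/-- The unrestricted wreath product `F ≀ ℤ`. An element is thought of as an arrow of length
`shift` starting at each integer `n`, labelled by `fn n`; products concatenate arrows. -/
@[ext]
structure Wreath (F : Type*) where
  /-- The labels. -/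
  fn : ℤ → F
  /-- The translation part. -/
  shift : ℤ

namespace Wreath

variable {F : Type*} [Group F]

instance : Mul (Wreath F) := ⟨fun x y => ⟨fun n => x.fn n * y.fn (n + x.shift), x.shift + y.shift⟩⟩
instance : One (Wreath F) := ⟨⟨fun _ => 1, 0⟩⟩
instance : Inv (Wreath F) := ⟨fun x => ⟨fun n => (x.fn (n - x.shift))⁻¹, -x.shift⟩⟩

@[simp] theorem mul_fn (x y : Wreath F) (n : ℤ) :
    (x * y).fn n = x.fn n * y.fn (n + x.shift) := rfl
@[simp] theorem mul_shift (x y : Wreath F) : (x * y).shift = x.shift + y.shift := rfl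
@[simp] theorem one_fn (n : ℤ) : (1 : Wreath F).fn n = 1 := rfl
@[simp] theorem one_shift : (1 : Wreath F).shift = 0 := rfl
@[simp] theorem inv_fn (x : Wreath F) (n : ℤ) : (x⁻¹).fn n = (x.fn (n - x.shift))⁻¹ := rfl
@[simp] theorem inv_shift (x : Wreath F) : (x⁻¹).shift = -x.shift := rfl

instance : Group (Wreath F) :=
  Group.ofLeftAxioms
    (fun x y z => by
      ext n
      · simp [mul_assoc, add_assoc]
      · simp [add_assoc])
    (fun x => by ext n <;> simp)
    (fun x => by ext n <;> simp [sub_eq_add_neg])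

theorem pow_shift (x : Wreath F) (k : ℕ) : (x ^ k).shift = k * x.shift := by
  induction k with
  | zero => simp
  | succ k ih => rw [pow_succ, mul_shift, ih]; push_cast; ring

theorem pow_fn_of_shift_eq_zero {x : Wreath F} (hx : x.shift = 0) (k : ℕ) (n : ℤ) :
    (x ^ k).fn n = x.fn n ^ k := by
  induction k with
  | zero => simp
  | succ k ih => rw [pow_succ, mul_fn, ih, pow_shift, hx]; simp [pow_succ]

theorem eq_one_of_isOfFinOrder [IsMulTorsionFree F] (x : Wreath F) (hx : IsOfFinOrder x) :
    x = 1 := by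
  obtain ⟨k, hk, hxk⟩ := isOfFinOrder_iff_pow_eq_one.1 hx
  have hs : x.shift = 0 := by
    have h := pow_shift x k
    rw [hxk, one_shift] at h
    rcases mul_eq_zero.1 h.symm with h | h
    · exact absurd (Int.natCast_eq_zero.1 h) hk.ne'
    · exact h
  ext n
  · have h := pow_fn_of_shift_eq_zero hs k n
    rw [hxk, one_fn] at h
    exact (pow_eq_one_iff_left hk.ne').1 h.symm
  · exact hs

end Wreath

/-- A recursion `y (m + 1) = L m (y m)` by bijections can be solved in both directions. -/
theorem Int.exists_recursion_one {T : Type*} (L : ℤ → Equiv.Perm T) (t : T) :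
    ∃ y : ℤ → T, ∀ m, y (m + 1) = L m (y m) := by
  let up : ℕ → T := fun n => Nat.rec t (fun k s => L k s) n
  let down : ℕ → T := fun n => Nat.rec t (fun k s => (L (-(k : ℤ) - 1)).symm s) n
  refine ⟨fun m => if 0 ≤ m then up m.toNat else down (-m).toNat, fun m => ?_⟩
  rcases lt_or_ge m 0 with hm | hm
  · obtain ⟨k, rfl⟩ : ∃ k : ℕ, m = -(k : ℤ) - 1 := ⟨(-m - 1).toNat, by omega⟩
    have e1 : (-(-(k : ℤ) - 1)).toNat = k + 1 := by omega
    have e3 : down (k + 1) = (L (-(k : ℤ) - 1)).symm (down k) := rfl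
    dsimp only
    rw [if_neg (show ¬ 0 ≤ -(k : ℤ) - 1 by omega), e1, e3, Equiv.apply_symm_apply]
    rcases Nat.eq_zero_or_pos k with rfl | hk
    · rfl
    · rw [if_neg (by omega)]
      congr 1
      omega
  · obtain ⟨k, rfl⟩ := Int.eq_ofNat_of_zero_le hm
    dsimp only
    rw [if_pos (by omega), if_pos (by omega)]
    have e1 : ((k : ℤ) + 1).toNat = k + 1 := by omega
    rw [e1]
    rfl

theorem Int.exists_recursion {T : Type*} (L : ℤ → Equiv.Perm T) (t : T) {k : ℤ} (hk : k ≠ 0) :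
    ∃ y : ℤ → T, ∀ m, y (m + k) = L m (y m) := by
  choose z hz using fun r : ℤ => Int.exists_recursion_one (fun i => L (r + k * i)) t
  refine ⟨fun m => z (m % k) (m / k), fun m => ?_⟩
  have h1 : (m + k) % k = m % k := Int.add_emod_right m k
  have h2 : (m + k) / k = m / k + 1 := Int.add_ediv_of_dvd_right (dvd_refl k) |>.trans (by
    rw [Int.ediv_self hk])
  simp only [h1, h2, hz, Int.emod_add_mul_ediv]

/-! ### Two generators in the group of a closed surface -/

section SurfaceGroup

open scoped commutatorElement

variable {P : Type*} [Group P] {F : Type*} [Group F]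

/-- For a homomorphism `φ` from `P` to the integers and a homomorphism `Ψ : F → P`: the pairs of an
element `w` of `F ≀ ℤ` and an element `ξ` of `P` such that `w` translates by `φ ξ` and all the
labels of `w` are mapped to `ξ` by `Ψ`. -/
def wreathOver (φ : P →* Multiplicative ℤ) (Ψ : F →* P) : Subgroup (Wreath F × P) where
  carrier := {p | p.1.shift = (φ p.2).toAdd ∧ ∀ m, Ψ (p.1.fn m) = p.2}
  mul_mem' := by
    rintro ⟨w, ξ⟩ ⟨w', ξ'⟩ ⟨h1, h2⟩ ⟨h1', h2'⟩
    exact ⟨by simpa using congrArg₂ (· + ·) h1 h1', fun m => by simp_all⟩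
  one_mem' := ⟨by simp, fun m => by simp⟩
  inv_mem' := by
    rintro ⟨w, ξ⟩ ⟨h1, h2⟩
    exact ⟨by simpa using h1, fun m => by simp_all⟩

theorem mem_wreathOver {φ : P →* Multiplicative ℤ} {Ψ : F →* P} {w : Wreath F} {ξ : P} :
    (w, ξ) ∈ wreathOver φ Ψ ↔ w.shift = (φ ξ).toAdd ∧ ∀ m, Ψ (w.fn m) = ξ := Iff.rfl

/-- Two elements of `F ≀ ℤ` with the same nonzero translation are conjugate, and the conjugating
element can be chosen over a given element of `P`. -/
theorem exists_wreathOver_conj {φ : P →* Multiplicative ℤ} {Ψ : F →* P} {x x' : Wreath F}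
    {ξ ξ' η : P} (hx : (x, ξ) ∈ wreathOver φ Ψ) (hx' : (x', ξ') ∈ wreathOver φ Ψ)
    (hη : η * ξ = ξ' * η) (hφ : φ ξ ≠ 1) (hΨ : ∃ f, Ψ f = η) :
    ∃ y, (y, η) ∈ wreathOver φ Ψ ∧ y * x = x' * y := by
  obtain ⟨hxs, hxf⟩ := mem_wreathOver.1 hx
  obtain ⟨hxs', hxf'⟩ := mem_wreathOver.1 hx'
  have hφ' : φ ξ' = φ ξ := by
    have h := congrArg φ hη
    rw [map_mul, map_mul, mul_comm] at h
    exact (mul_right_cancel h).symm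
  set k : ℤ := (φ ξ).toAdd with hk
  set μ : ℤ := (φ η).toAdd with hμ
  have hk0 : k ≠ 0 := fun h => hφ (by rw [← ofAdd_toAdd (φ ξ), ← hk, h, ofAdd_zero])
  have e1 : ξ'⁻¹ * η * ξ = η := by rw [mul_assoc, hη, inv_mul_cancel_left]
  have e2 : ξ' * η * ξ⁻¹ = η := by rw [← hη, mul_inv_cancel_right]
  -- Comparing labels in `y * x = x' * y` expresses the label of `y` at `m + k` by that at `m`.
  let L : ℤ → Equiv.Perm {f : F // Ψ f = η} := fun m =>
    { toFun := fun f => ⟨(x'.fn m)⁻¹ * f * x.fn (m + μ), by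
        rw [map_mul, map_mul, map_inv, hxf, hxf', f.2, e1]⟩
      invFun := fun f => ⟨x'.fn m * f * (x.fn (m + μ))⁻¹, by
        rw [map_mul, map_mul, map_inv, hxf, hxf', f.2, e2]⟩
      left_inv := fun f => Subtype.ext (by simp [mul_assoc])
      right_inv := fun f => Subtype.ext (by simp [mul_assoc]) }
  obtain ⟨f₀, hf₀⟩ := hΨ
  obtain ⟨y, hy⟩ := Int.exists_recursion L ⟨f₀, hf₀⟩ hk0
  refine ⟨⟨fun m => (y m : F), μ⟩, mem_wreathOver.2 ⟨rfl, fun m => (y m).2⟩, ?_⟩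
  ext m
  · have h : (y (m + k) : F) = (x'.fn m)⁻¹ * y m * x.fn (m + μ) := congrArg Subtype.val (hy m)
    simp only [Wreath.mul_fn, hxs', hφ']
    rw [← hk, h]
    simp [mul_assoc]
  · simp only [Wreath.mul_shift, hxs, hxs', hφ']
    exact add_comm _ _

/-- The product of the terms of a list `f 0, …, f (n - 1)` other than `f i`, starting after `f i`
and taken in cyclic order. -/
def prodRest {G : Type*} [Group G] (f : ℕ → G) (n i : ℕ) : G :=
  ((List.range' (i + 1) (n - 1 - i)).map f).prod * ((List.range i).map f).prod

theorem prod_range_eq_one_iff {G : Type*} [Group G] (f : ℕ → G) {n i : ℕ} (hi : i < n) :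
    ((List.range n).map f).prod = 1 ↔ f i * prodRest f n i = 1 := by
  have h : List.range n = List.range i ++ i :: List.range' (i + 1) (n - 1 - i) := by
    have h1 : n = i + (1 + (n - 1 - i)) := by omega
    conv_lhs => rw [h1]
    rw [List.range_eq_range', List.range_eq_range', ← List.range'_append_1, Nat.zero_add,
      Nat.add_comm 1, List.range'_succ]
  rw [h, prodRest, List.map_append, List.prod_append, List.map_cons, List.prod_cons,
    mul_eq_one_iff_inv_eq, ← mul_assoc, mul_eq_one_iff_eq_inv, eq_comm]

theorem prodRest_congr {G : Type*} [Group G] {f f' : ℕ → G} {n i : ℕ}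
    (h : ∀ j, j ≠ i → f j = f' j) : prodRest f n i = prodRest f' n i := by
  unfold prodRest
  congr 2
  · refine List.map_congr_left fun j hj => h j ?_
    have := List.mem_range'_1.1 hj
    omega
  · refine List.map_congr_left fun j hj => h j ?_
    have := List.mem_range.1 hj
    omega

theorem mk_prodRest_mem {G G' : Type*} [Group G] [Group G'] {K : Subgroup (G × G')} {f : ℕ → G}
    {f' : ℕ → G'} (h : ∀ j, (f j, f' j) ∈ K) (n i : ℕ) : (prodRest f n i, prodRest f' n i) ∈ K := by
  have hl : ∀ l : List ℕ, ((l.map f).prod, (l.map f').prod) ∈ K := by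
    intro l
    induction l with
    | nil => exact one_mem K
    | cons j l ih => simpa using mul_mem (h j) ih
  exact mul_mem (hl (List.range' (i + 1) (n - 1 - i))) (hl (List.range i))

/-- The group `P` has generators `s j`, `t j` for `j < n`, with the relation `∏ ⁅s j, t j⁆ = 1`, and
homomorphisms to torsion-free groups can be prescribed on the generators subject to this relation.
-/
structure IsSurfaceGroup (n : ℕ) (s t : ℕ → P) : Prop where
  closure_eq_top : Subgroup.closure {x | ∃ j < n, x = s j ∨ x = t j} = ⊤
  relation : ((List.range n).map fun j => ⁅s j, t j⁆).prod = 1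
  exists_hom : ∀ (G : Type) [Group G], (∀ x : G, IsOfFinOrder x → x = 1) → ∀ a b : ℕ → G,
    ((List.range n).map fun j => ⁅a j, b j⁆).prod = 1 →
      ∃ Λ : P →* G, ∀ j < n, Λ (s j) = a j ∧ Λ (t j) = b j

namespace IsSurfaceGroup

variable {n : ℕ} {s t : ℕ → P} (h : IsSurfaceGroup n s t)
include h

theorem exists_hom_int (a b : ℕ → ℤ) : ∃ Λ : P →* Multiplicative ℤ, ∀ j < n,
    Λ (s j) = Multiplicative.ofAdd (a j) ∧ Λ (t j) = Multiplicative.ofAdd (b j) := by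
  refine h.exists_hom (Multiplicative ℤ) (fun x hx => ?_) _ _ ?_
  · obtain ⟨k, hk, hxk⟩ := isOfFinOrder_iff_pow_eq_one.1 hx
    exact (pow_eq_one_iff_left hk.ne').1 hxk
  · apply List.prod_eq_one
    intro x hx
    obtain ⟨j, -, rfl⟩ := List.mem_map.1 hx
    rw [commutatorElement_eq_one_iff_mul_comm]
    exact mul_comm _ _

/-- Two elements are killed by a nontrivial homomorphism to the integers: two linear conditions are
imposed on a group of homomorphisms of rank at least four. -/
theorem exists_hom_int_eq_one (hn : 2 ≤ n) (α β : P) :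
    ∃ φ : P →* Multiplicative ℤ, φ α = 1 ∧ φ β = 1 ∧ ∃ j < n, φ (s j) ≠ 1 ∨ φ (t j) ≠ 1 := by
  choose f hf using fun i : Fin 2 × Bool => h.exists_hom_int
    (fun j => if j = i.1 ∧ i.2 = true then 1 else 0)
    (fun j => if j = i.1 ∧ i.2 = false then 1 else 0)
  -- The two conditions are the first two rows of a square matrix, whose other rows are zero.
  let M : Matrix (Fin 2 × Bool) (Fin 2 × Bool) ℤ := fun r i =>
    if r = (0, true) then (f i α).toAdd else if r = (0, false) then (f i β).toAdd else 0
  have hdet : M.det = 0 := Matrix.det_eq_zero_of_row_eq_zero (1, true) fun i => by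
    simp only [M]
    rw [if_neg (by decide), if_neg (by decide)]
  obtain ⟨c, hc0, hc⟩ := Matrix.exists_mulVec_eq_zero_iff.2 hdet
  let φ : P →* Multiplicative ℤ := ∏ i, f i ^ c i
  have hφ : ∀ ξ, (φ ξ).toAdd = ∑ i, c i * (f i ξ).toAdd := by
    intro ξ
    simp only [φ, MonoidHom.finsetProd_apply, toAdd_prod]
    refine Finset.sum_congr rfl fun i _ => ?_
    rw [MonoidHom.zpow_apply, toAdd_zpow, smul_eq_mul]
  have hone : ∀ ξ, (∑ i, c i * (f i ξ).toAdd) = 0 → φ ξ = 1 := fun ξ hξ =>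
    Multiplicative.toAdd.injective (by rw [hφ, hξ]; rfl)
  refine ⟨φ, hone _ ?_, hone _ ?_, ?_⟩
  · have := congrFun hc (0, true)
    simpa [Matrix.mulVec, dotProduct, M, mul_comm] using this
  · have := congrFun hc (0, false)
    simpa [Matrix.mulVec, dotProduct, M, mul_comm] using this
  · obtain ⟨⟨j, b⟩, hj⟩ := Function.ne_iff.1 hc0
    have hjn : (j : ℕ) < n := by omega
    refine ⟨j, hjn, ?_⟩
    have hne : ∀ ξ, (φ ξ).toAdd = c (j, b) → φ ξ ≠ 1 := by
      intro ξ hξ h1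
      rw [h1] at hξ
      exact hj hξ.symm
    cases b with
    | true =>
      refine Or.inl (hne _ ?_)
      rw [hφ, Finset.sum_eq_single (j, true)]
      · rw [(hf _ _ hjn).1]; simp
      · rintro ⟨i, b⟩ - hib
        rw [(hf _ _ hjn).1, if_neg]
        · simp
        · rintro ⟨h1, h2⟩
          exact hib (Prod.ext (Fin.ext h1.symm) h2)
      · simp
    | false =>
      refine Or.inr (hne _ ?_)
      rw [hφ, Finset.sum_eq_single (j, false)]
      · rw [(hf _ _ hjn).2]; simp
      · rintro ⟨i, b⟩ - hib
        rw [(hf _ _ hjn).2, if_neg]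
        · simp
        · rintro ⟨h1, h2⟩
          exact hib (Prod.ext (Fin.ext h1.symm) h2)
      · simp

/-- A homomorphism to the integers which does not vanish on the generators lifts to a homomorphism
to `F ≀ ℤ`, with `F` free, of which each label map is inverted by a homomorphism `F → P`. The
letters of `F` are the edges of the infinite cyclic cover of the Cayley complex; as the edges over
one of the generators can be solved for in the relators, the cover is homotopy equivalent to a
graph. -/
theorem exists_hom_wreath {φ : P →* Multiplicative ℤ} {i : ℕ} (hi : i < n)
    (hφ : φ (s i) ≠ 1 ∨ φ (t i) ≠ 1) :
    ∃ (Ψ : FreeGroup (ℕ × Bool × ℤ) →* P) (Λ : P →* Wreath (FreeGroup (ℕ × Bool × ℤ))),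
      ∀ ξ, (Λ ξ, ξ) ∈ wreathOver φ Ψ := by
  let Ψ : FreeGroup (ℕ × Bool × ℤ) →* P := FreeGroup.lift fun p => cond p.2.1 (s p.1) (t p.1)
  let A : ℕ → Wreath (FreeGroup (ℕ × Bool × ℤ)) := fun j =>
    ⟨fun m => FreeGroup.of (j, true, m), (φ (s j)).toAdd⟩
  let B : ℕ → Wreath (FreeGroup (ℕ × Bool × ℤ)) := fun j =>
    ⟨fun m => FreeGroup.of (j, false, m), (φ (t j)).toAdd⟩
  have hA : ∀ j, (A j, s j) ∈ wreathOver φ Ψ := fun j =>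
    mem_wreathOver.2 ⟨rfl, fun m => by simp [A, Ψ]⟩
  have hB : ∀ j, (B j, t j) ∈ wreathOver φ Ψ := fun j =>
    mem_wreathOver.2 ⟨rfl, fun m => by simp [B, Ψ]⟩
  have hcomm : ∀ {w w' : Wreath (FreeGroup (ℕ × Bool × ℤ))} {ξ ξ' : P},
      (w, ξ) ∈ wreathOver φ Ψ → (w', ξ') ∈ wreathOver φ Ψ →
        (⁅w, w'⁆, ⁅ξ, ξ'⁆) ∈ wreathOver φ Ψ := by
    intro w w' ξ ξ' h1 h2
    simpa [commutatorElement_def] using mul_mem (mul_mem (mul_mem h1 h2) (inv_mem h1)) (inv_mem h2)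
  set C := prodRest (fun j => ⁅A j, B j⁆) n i with hC
  set d := prodRest (fun j => ⁅s j, t j⁆) n i with hd
  have hCd : (C, d) ∈ wreathOver φ Ψ := mk_prodRest_mem (fun j => hcomm (hA j) (hB j)) n i
  have hrel : ⁅s i, t i⁆ * d = 1 := (prod_range_eq_one_iff _ hi).1 h.relation
  rw [commutatorElement_def] at hrel
  -- It is enough to modify the lift of one generator so that the relation holds.
  suffices hab : ∃ a b : ℕ → Wreath (FreeGroup (ℕ × Bool × ℤ)),
      (∀ j, (a j, s j) ∈ wreathOver φ Ψ) ∧ (∀ j, (b j, t j) ∈ wreathOver φ Ψ) ∧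
        (∀ j, j ≠ i → a j = A j ∧ b j = B j) ∧ ⁅a i, b i⁆ * C = 1 by
    obtain ⟨a, b, ha, hb, hne, hr⟩ := hab
    have hprod : ((List.range n).map fun j => ⁅a j, b j⁆).prod = 1 := by
      rw [prod_range_eq_one_iff _ hi, prodRest_congr (f' := fun j => ⁅A j, B j⁆)]
      · exact hr
      · intro j hj
        simp only [(hne j hj).1, (hne j hj).2]
    obtain ⟨Λ, hΛ⟩ := h.exists_hom _ Wreath.eq_one_of_isOfFinOrder a b hprod
    refine ⟨Ψ, Λ, fun ξ => ?_⟩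
    have hle : Subgroup.closure {x | ∃ j < n, x = s j ∨ x = t j} ≤
        (wreathOver φ Ψ).comap (Λ.prod (MonoidHom.id P)) := by
      rw [Subgroup.closure_le]
      rintro x ⟨j, hj, rfl | rfl⟩
      · change (Λ (s j), s j) ∈ wreathOver φ Ψ
        rw [(hΛ j hj).1]
        exact ha j
      · change (Λ (t j), t j) ∈ wreathOver φ Ψ
        rw [(hΛ j hj).2]
        exact hb j
    rw [h.closure_eq_top] at hle
    exact hle (Subgroup.mem_top ξ)
  rcases hφ with hφ | hφ
  · obtain ⟨y, hy, hyx⟩ := exists_wreathOver_conj (η := t i) (ξ := (s i)⁻¹) (ξ' := (s i)⁻¹ * d⁻¹)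
      (x := (A i)⁻¹) (x' := (A i)⁻¹ * C⁻¹) (φ := φ) (Ψ := Ψ) (inv_mem (hA i))
      (mul_mem (inv_mem (hA i)) (inv_mem hCd))
      (by
        rw [mul_eq_one_iff_inv_eq] at hrel
        rw [← hrel]
        group)
      (by rw [map_inv]; exact inv_ne_one.2 hφ) ⟨FreeGroup.of (i, false, 0), by simp [Ψ]⟩
    refine ⟨A, Function.update B i y, hA, fun j => ?_, fun j hj => ⟨rfl, ?_⟩, ?_⟩
    · rcases eq_or_ne j i with rfl | hj
      · simpa using hy
      · simpa [hj] using hB j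
    · simp [hj]
    · rw [Function.update_self, commutatorElement_def, mul_assoc (A i), hyx]
      group
  · obtain ⟨y, hy, hyx⟩ := exists_wreathOver_conj (η := s i) (ξ := t i) (ξ' := d⁻¹ * t i)
      (x := B i) (x' := C⁻¹ * B i) (φ := φ) (Ψ := Ψ) (hB i)
      (mul_mem (inv_mem hCd) (hB i))
      (by
        rw [mul_eq_one_iff_eq_inv] at hrel
        rw [← hrel]
        group)
      hφ ⟨FreeGroup.of (i, true, 0), by simp [Ψ]⟩
    refine ⟨Function.update A i y, B, fun j => ?_, hB, fun j hj => ⟨?_, rfl⟩, ?_⟩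
    · rcases eq_or_ne j i with rfl | hj
      · simpa using hy
      · simpa [hj] using hA j
    · simp [hj]
    · rw [Function.update_self, commutatorElement_def, hyx]
      group

/-- In the group of a closed surface of genus at least two, two elements either lie in a common
cyclic subgroup or freely generate a free semigroup. -/
theorem mem_zpowers_or_wordEval_injective (hn : 2 ≤ n) (α β : P) :
    (∃ c, α ∈ Subgroup.zpowers c ∧ β ∈ Subgroup.zpowers c) ∨
      Function.Injective (wordEval α β) := by
  obtain ⟨φ, hα, hβ, i, hi, hφ⟩ := h.exists_hom_int_eq_one hn α β
  obtain ⟨Ψ, Λ, hΛ⟩ := h.exists_hom_wreath hi hφ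
  have hΨ : ∀ ξ, Ψ ((Λ ξ).fn 0) = ξ := fun ξ => (hΛ ξ).2 0
  let K : φ.ker →* FreeGroup (ℕ × Bool × ℤ) :=
    { toFun := fun ξ => (Λ ξ).fn 0
      map_one' := by simp
      map_mul' := fun ξ ξ' => by
        have : (Λ (ξ : P)).shift = 0 := by rw [(hΛ _).1, ξ.2]; rfl
        simp [this] }
  rcases FreeGroup.mem_zpowers_or_wordEval_injective (K ⟨α, hα⟩) (K ⟨β, hβ⟩) with
    ⟨c, ⟨k, hk⟩, ⟨l, hl⟩⟩ | hinj
  · refine Or.inl ⟨Ψ c, ⟨k, ?_⟩, ⟨l, ?_⟩⟩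
    · have := congrArg Ψ hk
      exact (by simpa using this.trans (hΨ α))
    · have := congrArg Ψ hl
      exact (by simpa using this.trans (hΨ β))
  · refine Or.inr fun w₁ w₂ hw => hinj ?_
    rw [← map_wordEval, ← map_wordEval]
    congr 1
    apply Subtype.ext
    have e : ∀ w, ((wordEval (⟨α, hα⟩ : φ.ker) ⟨β, hβ⟩ w : φ.ker) : P) = wordEval α β w :=
      fun w => map_wordEval φ.ker.subtype _ _ w
    rw [e, e, hw]

end IsSurfaceGroup

end SurfaceGroup

/-! ### Fundamental groups of quotients of simply connected compact spaces -/

section Quotients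

open Path

variable {D X : Type*} [TopologicalSpace D] [TopologicalSpace X]

/-- The loop which follows `a` and returns along `b`, as an element of the opposite of the
fundamental group, where products are concatenations in the order of reading. -/
def differenceLoop {v x y : X} (a : Homotopic.Quotient v x) (b : Homotopic.Quotient v y)
    (h : x = y) : (FundamentalGroup X v)ᵐᵒᵖ :=
  MulOpposite.op (FundamentalGroup.fromPath (a.trans (b.cast rfl h).symm))

theorem op_fromPath_mul {v : X} (a b : Homotopic.Quotient v v) :
    MulOpposite.op (FundamentalGroup.fromPath a) * MulOpposite.op (FundamentalGroup.fromPath b) =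
      MulOpposite.op (FundamentalGroup.fromPath (a.trans b)) := rfl

theorem differenceLoop_mul {v x y z : X} (a : Homotopic.Quotient v x) (b : Homotopic.Quotient v y)
    (c : Homotopic.Quotient v z) (h : x = y) (h' : y = z) :
    differenceLoop a b h * differenceLoop b c h' = differenceLoop a c (h.trans h') := by
  subst h h'
  simp only [differenceLoop, Homotopic.Quotient.cast_rfl_rfl, op_fromPath_mul]
  congr 2
  rw [Homotopic.Quotient.trans_assoc, ← Homotopic.Quotient.trans_assoc b.symm,
    Homotopic.Quotient.symm_trans, Homotopic.Quotient.refl_trans]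

theorem differenceLoop_self {v x : X} (a : Homotopic.Quotient v x) :
    differenceLoop a a rfl = 1 := by
  simp only [differenceLoop, Homotopic.Quotient.cast_rfl_rfl, Homotopic.Quotient.trans_symm]
  rfl

theorem Path.Homotopic.Quotient.symm_of_trans {x y z : X} (a : Homotopic.Quotient x y)
    (b : Homotopic.Quotient y z) :
    (a.trans b).symm = b.symm.trans a.symm := by
  induction a with | mk a =>
  induction b with | mk b =>
  simp only [← Homotopic.Quotient.mk_symm, ← Homotopic.Quotient.mk_trans, Path.trans_symm]

theorem differenceLoop_trans {v x y x' y' : X} (a : Homotopic.Quotient v x)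
    (b : Homotopic.Quotient v y) (e : Homotopic.Quotient x x') (e' : Homotopic.Quotient y y')
    (h : x = y) (h' : x' = y') (he : e = e'.cast h h') :
    differenceLoop (a.trans e) (b.trans e') h' = differenceLoop a b h := by
  subst h h' he
  simp only [differenceLoop, Homotopic.Quotient.cast_rfl_rfl]
  congr 2
  rw [Homotopic.Quotient.symm_of_trans, Homotopic.Quotient.trans_assoc,
    ← Homotopic.Quotient.trans_assoc e', Homotopic.Quotient.trans_symm,
    Homotopic.Quotient.refl_trans]

variable [SimplyConnectedSpace D] (q : C(D, X)) (p₀ : D)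

/-- The class of the image under `q` of the paths from `p₀` to `d`. -/
def sheetClass (d : D) : Homotopic.Quotient (q p₀) (q d) :=
  (Homotopic.Quotient.mk (PathConnectedSpace.somePath p₀ d)).map q

theorem sheetClass_eq {d : D} (δ : Path p₀ d) :
    sheetClass q p₀ d = (Homotopic.Quotient.mk δ).map q := by
  unfold sheetClass
  congr 1
  exact Subsingleton.elim _ _

theorem sheetClass_trans {d d' : D} (δ : Path d d') :
    (sheetClass q p₀ d).trans ((Homotopic.Quotient.mk δ).map q) = sheetClass q p₀ d' := by
  rw [sheetClass_eq q p₀ ((PathConnectedSpace.somePath p₀ d).trans δ), sheetClass,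
    ← Homotopic.Quotient.mk_map, ← Homotopic.Quotient.mk_map, ← Homotopic.Quotient.mk_map,
    ← Homotopic.Quotient.mk_trans, Path.map_trans]

theorem sheetClass_self : sheetClass q p₀ p₀ = Homotopic.Quotient.refl _ := by
  rw [sheetClass_eq q p₀ (Path.refl p₀), ← Homotopic.Quotient.mk_map]
  rfl

variable {q}

/-- For two points `d`, `d'` with the same image: the loop which is the image of a path from `p₀`
to `d` followed by a path from `d'` to `p₀`. -/
def transition {d d' : D} (h : q d = q d') : (FundamentalGroup X (q p₀))ᵐᵒᵖ :=
  differenceLoop (sheetClass q p₀ d) (sheetClass q p₀ d') h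

theorem transition_mul {d d' d'' : D} (h : q d = q d') (h' : q d' = q d'') :
    transition p₀ h * transition p₀ h' = transition p₀ (h.trans h') :=
  differenceLoop_mul _ _ _ h h'

theorem transition_self (d : D) : transition p₀ (rfl : q d = q d) = 1 :=
  differenceLoop_self _

theorem transition_congr {d₁ d₂ d₁' d₂' : D} (hd : d₁ = d₂) (hd' : d₁' = d₂')
    (h : q d₁ = q d₁') (h' : q d₂ = q d₂') : transition p₀ h = transition p₀ h' := by
  subst hd hd'
  rfl

theorem transition_symm {d d' : D} (h : q d = q d') :
    transition p₀ h.symm = (transition p₀ h)⁻¹ :=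
  eq_inv_of_mul_eq_one_left (by rw [transition_mul, transition_self])

/-- The transition loop does not change when the two points move in such a way that their images
remain equal. -/
theorem transition_eq_of_paths {d₁ d₂ d₁' d₂' : D} (δ : Path d₁ d₂) (δ' : Path d₁' d₂')
    (h : ∀ t, q (δ t) = q (δ' t)) (h₁ : q d₁ = q d₁') (h₂ : q d₂ = q d₂') :
    transition p₀ h₂ = transition p₀ h₁ := by
  unfold transition
  rw [← sheetClass_trans q p₀ δ, ← sheetClass_trans q p₀ δ']
  refine differenceLoop_trans _ _ _ _ _ _ ?_
  rw [← Homotopic.Quotient.mk_map, ← Homotopic.Quotient.mk_map, ← Homotopic.Quotient.mk_cast]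
  congr 1
  ext t
  exact h t

/-- If a loop-like class `c` from the base point is continued by a class `e` which is the image of a
path in `D`, its difference with the sheet does not change. -/
theorem differenceLoop_sheetClass {x x' : X} (c : Homotopic.Quotient (q p₀) x)
    (e : Homotopic.Quotient x x') {d d' : D} (hd : x = q d) (hd' : x' = q d') (δ : Path d d')
    (he : e = ((Homotopic.Quotient.mk δ).map q).cast hd hd') :
    differenceLoop (c.trans e) (sheetClass q p₀ d') hd' =
      differenceLoop c (sheetClass q p₀ d) hd := by
  rw [← sheetClass_trans q p₀ δ]
  exact differenceLoop_trans _ _ _ _ _ _ he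

/-- The fundamental group of a semilocally simply connected Hausdorff quotient of a simply connected
compact space is generated by the transition loops. Along a loop `γ`, let `g t` be the class of
`γ` up to time `t`, followed by the image of a path back to `p₀`. Its coset by the subgroup
generated by the transition loops is locally constant, because the points of `D` over
`γ t'` are close to those over `γ t` when `t'` is close to `t`. -/
theorem eq_top_of_transition_mem [CompactSpace D] [T2Space X] (hq : Function.Surjective q)
    (hD : ∀ d : D, ∀ U ∈ 𝓝 d, ∃ V ∈ 𝓝 d, ∀ d' ∈ V, ∃ γ : Path d' d, range γ ⊆ U)
    (hX : ∀ x : X, ∃ O ∈ 𝓝 x, ∀ (y z : X) (γ γ' : Path y z), range γ ⊆ O → range γ' ⊆ O →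
      γ.Homotopic γ')
    (N : Subgroup (FundamentalGroup X (q p₀))ᵐᵒᵖ)
    (hN : ∀ (d d' : D) (h : q d = q d'), transition p₀ h ∈ N) : N = ⊤ := by
  rw [eq_top_iff]
  rintro ⟨c⟩ -
  change MulOpposite.op c ∈ N
  induction c using Homotopic.Quotient.ind with | mk γ =>
  let c : ∀ t : I, Homotopic.Quotient (q p₀) (γ t) := fun t =>
    (Homotopic.Quotient.mk (γ.subpath 0 t)).cast γ.source.symm rfl
  -- The set of times at which `g t` belongs to `N`, which does not depend on the choice of the point
  -- over `γ t`.
  let T : I → Prop := fun t =>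
    ∃ (d : D) (h : γ t = q d), differenceLoop (c t) (sheetClass q p₀ d) h ∈ N
  have hT : ∀ t, T t → ∀ (d : D) (h : γ t = q d),
      differenceLoop (c t) (sheetClass q p₀ d) h ∈ N := by
    rintro t ⟨d', h', hm⟩ d h
    rw [← differenceLoop_mul _ (sheetClass q p₀ d') _ h' (h'.symm.trans h)]
    exact mul_mem hm (hN _ _ _)
  have hstep : ∀ s t : I, c t = (c s).trans (Homotopic.Quotient.mk (γ.subpath s t)) := by
    intro s t
    have h1 : Homotopic.Quotient.mk (γ.subpath 0 t) =
        (Homotopic.Quotient.mk (γ.subpath 0 s)).trans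
          (Homotopic.Quotient.mk (γ.subpath s t)) := by
      rw [← Homotopic.Quotient.mk_trans, Homotopic.Quotient.eq]
      exact ⟨(Path.Homotopy.subpathTransSubpath γ 0 s t).symm⟩
    have h2 : ∀ {v v' x y : X} (hv : v' = v) (a : Homotopic.Quotient v x)
        (b : Homotopic.Quotient x y),
        (a.trans b).cast hv rfl = (a.cast hv rfl).trans b := by
      rintro v v' x y rfl a b
      simp
    simp only [c]
    rw [h1, h2]
  have hcl : IsClosedMap q := q.continuous.isClosedMap
  have hloc : ∀ t : I, ∀ᶠ t' in 𝓝 t, T t' ↔ T t := by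
    intro t
    obtain ⟨O, hO, hOγ⟩ := hX (γ t)
    let W : Set D := {d' | ∃ d, q d = γ t ∧ ∃ δ : Path d' d, range δ ⊆ q ⁻¹' O}
    have hW : ∀ d, q d = γ t → W ∈ 𝓝 d := by
      intro d hd
      obtain ⟨V, hV, hVδ⟩ := hD d (q ⁻¹' O) (q.continuous.continuousAt (by rwa [hd]))
      exact mem_of_superset hV fun d' hd' => ⟨d, hd, hVδ d' hd'⟩
    -- Since `q` is closed, the fibres near that of `γ t` are contained in the neighbourhood `W` of it.
    have hW' : ∀ᶠ x in 𝓝 (γ t), ∀ d', q d' = x → d' ∈ W :=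
      hcl.eventually_nhds_fiber (p := fun d' => d' ∈ W) (γ t) hW
    have h1 : ∀ᶠ t' in 𝓝 t, ∀ d', q d' = γ t' → d' ∈ W := γ.continuous.continuousAt.eventually hW'
    have h2 : ∀ᶠ t' in 𝓝 t, range (γ.subpath t' t) ⊆ O := by
      have hOc : γ ⁻¹' O ∈ 𝓝 t := γ.continuous.continuousAt hO
      obtain ⟨ε, hε, hb⟩ := Metric.mem_nhds_iff.1 hOc
      filter_upwards [Metric.ball_mem_nhds t hε] with t' ht'
      rw [Path.range_subpath]
      rintro _ ⟨u, hu, rfl⟩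
      refine hb ?_
      rw [Metric.mem_ball] at ht' ⊢
      refine lt_of_le_of_lt ?_ ht'
      have hu' : (u : ℝ) ∈ uIcc (t' : ℝ) t := by
        rcases le_total t' t with h | h
        · rw [uIcc_of_le h] at hu; rw [uIcc_of_le (show (t' : ℝ) ≤ t from h)]; exact hu
        · rw [uIcc_of_ge h] at hu; rw [uIcc_of_ge (show (t : ℝ) ≤ t' from h)]; exact hu
      rw [Subtype.dist_eq, Subtype.dist_eq]
      exact Real.dist_right_le_of_mem_uIcc hu'
    filter_upwards [h1, h2] with t' ht1 ht2
    obtain ⟨d', hd'⟩ := hq (γ t')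
    obtain ⟨d, hd, δ, hδ⟩ := ht1 d' hd'
    have key : differenceLoop (c t) (sheetClass q p₀ d) hd.symm =
        differenceLoop (c t') (sheetClass q p₀ d') hd'.symm := by
      rw [hstep t' t]
      refine differenceLoop_sheetClass p₀ _ _ hd'.symm hd.symm δ ?_
      rw [← Homotopic.Quotient.mk_map, ← Homotopic.Quotient.mk_cast, Homotopic.Quotient.eq]
      refine hOγ _ _ _ _ ht2 ?_
      rintro _ ⟨u, rfl⟩
      exact hδ ⟨u, rfl⟩
    constructor
    · intro h
      refine ⟨d, hd.symm, ?_⟩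
      rw [key]
      exact hT _ h _ _
    · intro h
      refine ⟨d', hd'.symm, ?_⟩
      rw [← key]
      exact hT _ h _ _
  have hclopen : IsClopen {t | T t} := by
    refine ⟨⟨isOpen_iff_mem_nhds.2 fun t ht => ?_⟩, isOpen_iff_mem_nhds.2 fun t ht => ?_⟩
    · filter_upwards [hloc t] with t' h using fun h' => ht (h.1 h')
    · filter_upwards [hloc t] with t' h using h.2 ht
  have h0 : T 0 := by
    refine ⟨p₀, γ.source, ?_⟩
    have hc : c 0 = (Homotopic.Quotient.refl (q p₀)).cast rfl γ.source := by
      simp only [c, Path.subpath_self]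
      rw [← Homotopic.Quotient.mk_refl, ← Homotopic.Quotient.mk_cast, ← Homotopic.Quotient.mk_cast]
      congr 1
      ext t
      exact γ.source
    have h2 : ∀ {v x : X} (hx : x = v), differenceLoop ((Homotopic.Quotient.refl v).cast rfl hx)
        (Homotopic.Quotient.refl v) hx = 1 := by
      rintro v x rfl
      exact differenceLoop_self _
    rw [hc, sheetClass_self, h2]
    exact one_mem N
  have h1 : T 1 := by
    have h : (1 : I) ∈ {t | T t} := by
      rw [hclopen.eq_univ ⟨0, h0⟩]
      trivial
    exact h
  have hfin := hT 1 h1 p₀ γ.target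
  have hc : c 1 = (Homotopic.Quotient.mk γ).cast rfl γ.target := by
    simp only [c, Path.subpath_zero_one]
    rw [← Homotopic.Quotient.mk_cast, ← Homotopic.Quotient.mk_cast]
    congr 1
  have h2 : ∀ {v x : X} (hx : x = v) (a : Homotopic.Quotient v v),
      differenceLoop (a.cast rfl hx) (Homotopic.Quotient.refl v) hx =
        MulOpposite.op (FundamentalGroup.fromPath a) := by
    rintro v x rfl a
    simp only [differenceLoop, Homotopic.Quotient.cast_rfl_rfl]
    congr 2
    rw [← Homotopic.Quotient.trans_refl (a.trans _), Homotopic.Quotient.trans_assoc,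
      Homotopic.Quotient.symm_trans, Homotopic.Quotient.trans_refl]
  rw [hc, sheetClass_self, h2] at hfin
  exact hfin

end Quotients

/-! ### Homomorphisms from the fundamental group of a quotient -/

section Lifting

open Path

/-- A map `f` from `D` to a space `Y` with a free and properly discontinuous action of `G`, such
that points of `D` identified in `X` are sent to the same orbit, induces a map from `X` to the
orbit space, and hence a homomorphism from the fundamental group of `X` to `G`. -/
theorem exists_hom_of_equivariant {D X Y G : Type*} [TopologicalSpace D] [TopologicalSpace X]
    [TopologicalSpace Y] [Group G] [MulAction G Y] [ContinuousConstSMul G Y]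
    [SimplyConnectedSpace D] {q : C(D, X)} (hq : IsQuotientMap q) (p₀ : D)
    (hG : ∀ y : Y, ∃ U ∈ 𝓝 y, ∀ g : G, ((g • ·) '' U ∩ U).Nonempty → g = 1)
    (f : C(D, Y)) (hf : ∀ d d', q d = q d' → ∃ g : G, f d = g • f d') :
    ∃ Λ : (FundamentalGroup X (q p₀))ᵐᵒᵖ →* G, ∀ (d d' : D) (h : q d = q d') (g : G),
      f d = g • f d' → Λ (transition p₀ h) = g := by
  let π : Y → MulAction.orbitRel.Quotient G Y := fun y => Quotient.mk'' y
  have hπ : IsQuotientCoveringMap π G :=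
    { isQuotientMap_quotient_mk' with
      continuous_const_smul := continuous_const_smul
      apply_eq_iff_mem_orbit := Quotient.eq''
      disjoint := hG }
  have hπc : Continuous π := hπ.isCoveringMap.continuous
  have hfac : Function.FactorsThrough ((⟨π, hπc⟩ : C(Y, _)).comp f) q := by
    intro d d' h
    obtain ⟨g, hg⟩ := hf d d' h
    change π (f d) = π (f d')
    rw [hg]
    exact hπ.map_smul g
  let F : C(X, MulAction.orbitRel.Quotient G Y) :=
    IsQuotientMap.lift (f := q) hq ((⟨π, hπc⟩ : C(Y, _)).comp f) hfac
  have hF : ∀ d, F (q d) = π (f d) := fun d =>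
    congrArg (fun φ : C(D, _) => φ d)
      (IsQuotientMap.lift_comp (f := q) hq ((⟨π, hπc⟩ : C(Y, _)).comp f) hfac)
  let e : π ⁻¹' {F (q p₀)} := ⟨f p₀, (hF p₀).symm⟩
  let θ : FundamentalGroup X (q p₀) →* Gᵐᵒᵖ :=
    (hπ.fundamentalGroupToMulOpposite e).comp (FundamentalGroup.map F (q p₀))
  refine ⟨(MulEquiv.opOp G).symm.toMonoidHom.comp (MonoidHom.op θ), fun d d' h g hg => ?_⟩
  suffices hθ : θ (transition p₀ h).unop = MulOpposite.op g by
    change ((θ (transition p₀ h).unop)).unop = g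
    rw [hθ]
    rfl
  change hπ.fundamentalGroupToMulOpposite e (FundamentalGroup.map F (q p₀) _) = _
  rw [IsQuotientCoveringMap.fundamentalGroupToMulOpposite_apply_eq_Iff]
  let δ := PathConnectedSpace.somePath p₀ d
  let δ' := PathConnectedSpace.somePath p₀ d'
  -- The lift goes along `f δ` and comes back along the translate by `g` of `f δ'`.
  let Γ : Path (f p₀) (g • f p₀) := (δ.map f.continuous).trans
    ((((δ'.map f.continuous).map (continuous_const_smul g)).symm).cast hg rfl)
  have hΓ : ∀ t, π (Γ t) = F (((δ.map q.continuous).trans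
      ((δ'.map q.continuous).cast rfl h).symm) t) := by
    intro t
    simp only [Γ, Path.trans_apply]
    split_ifs with ht
    · exact (hF _).symm
    · exact (hπ.map_smul g).trans (hF _).symm
  -- The end point of the lift.
  let e' : π ⁻¹' {F (q p₀)} := ⟨g • f p₀, (hπ.map_smul g).trans (hF p₀).symm⟩
  have key := hπ.isCoveringMap.monodromy_eq_of_map_eq
    (γ := FundamentalGroup.map F (q p₀) (transition p₀ h).unop) (ex := e) (ey := e')
    (Homotopic.Quotient.mk Γ) ?_
  · rw [key]
    rfl
  · change _ = Homotopic.Quotient.cast (Homotopic.Quotient.map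
      ((sheetClass q p₀ d).trans ((sheetClass q p₀ d').cast rfl h).symm) F) _ _
    unfold sheetClass
    rw [← Homotopic.Quotient.mk_map, ← Homotopic.Quotient.mk_map, ← Homotopic.Quotient.mk_map,
      ← Homotopic.Quotient.mk_cast, ← Homotopic.Quotient.mk_symm, ← Homotopic.Quotient.mk_trans,
      ← Homotopic.Quotient.mk_map]
    exact congrArg Homotopic.Quotient.mk (a₂ := Path.cast _ _ _) (Path.ext (funext hΓ))

end Lifting

/-! ### A space with a free action of a torsion-free group -/

open scoped BoundedContinuousFunction

/-- The nonzero real functions with finite support on a discrete group, with the topology of uniform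
convergence. -/
def FiniteChain (G : Type*) [TopologicalSpace G] : Type _ :=
  {μ : G →ᵇ ℝ // (Function.support μ).Finite ∧ μ ≠ 0}

namespace FiniteChain

variable {G : Type*} [Group G] [TopologicalSpace G] [DiscreteTopology G]

instance : TopologicalSpace (FiniteChain G) := inferInstanceAs (TopologicalSpace (Subtype _))

/-- The left translation by `g` of a bounded function. -/
def translate (g : G) (μ : G →ᵇ ℝ) : G →ᵇ ℝ :=
  μ.compContinuous ⟨fun h => g⁻¹ * h, continuous_of_discreteTopology⟩

@[simp] theorem translate_apply (g : G) (μ : G →ᵇ ℝ) (h : G) :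
    translate g μ h = μ (g⁻¹ * h) := rfl

theorem dist_translate (g : G) (μ ν : G →ᵇ ℝ) :
    dist (translate g μ) (translate g ν) = dist μ ν := by
  refine le_antisymm ((BoundedContinuousFunction.dist_le dist_nonneg).2 fun h => ?_)
    ((BoundedContinuousFunction.dist_le dist_nonneg).2 fun h => ?_)
  · exact BoundedContinuousFunction.dist_coe_le_dist (f := μ) (g := ν) (g⁻¹ * h)
  · have := BoundedContinuousFunction.dist_coe_le_dist (f := translate g μ) (g := translate g ν)
      (g * h)
    simpa using this

theorem finite_support_translate {g : G} {μ : G →ᵇ ℝ} (hμ : (Function.support μ).Finite) :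
    (Function.support (translate g μ)).Finite := by
  have : Function.support (translate g μ) = (fun h => g⁻¹ * h) ⁻¹' Function.support μ := rfl
  rw [this]
  exact hμ.preimage (mul_right_injective g⁻¹).injOn

instance : MulAction G (FiniteChain G) where
  smul g μ := ⟨translate g μ.1, finite_support_translate μ.2.1, fun h => μ.2.2 (by
    ext x
    have := congrArg (fun ν : G →ᵇ ℝ => ν (g * x)) h
    simpa using this)⟩
  one_smul μ := Subtype.ext (by
    change translate 1 μ.1 = μ.1
    ext x
    simp)
  mul_smul g g' μ := Subtype.ext (by
    change translate (g * g') μ.1 = translate g (translate g' μ.1)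
    ext x
    simp [mul_assoc])

theorem smul_val (g : G) (μ : FiniteChain G) : (g • μ).1 = translate g μ.1 := rfl

instance : ContinuousConstSMul G (FiniteChain G) where
  continuous_const_smul g := by
    refine Continuous.subtype_mk ?_ _
    exact (Isometry.of_dist_eq (dist_translate g)).continuous.comp continuous_subtype_val

/-- A torsion-free group acts freely on the finite chains, since the orbits of a nontrivial element
on the group are infinite. -/
theorem eq_one_of_smul_eq (hG : ∀ x : G, IsOfFinOrder x → x = 1) {g : G} {μ : FiniteChain G}
    (h : g • μ = μ) : g = 1 := by
  apply hG
  by_contra hg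
  obtain ⟨x, hx⟩ : ∃ x, μ.1 x ≠ 0 := by
    by_contra! hx
    exact μ.2.2 (BoundedContinuousFunction.ext hx)
  have hpow : ∀ n : ℕ, μ.1 (g ^ n * x) = μ.1 x := by
    intro n
    induction n with
    | zero => simp
    | succ n ih =>
      rw [← ih]
      have h1 := congrArg (fun ν : FiniteChain G => ν.1 (g ^ (n + 1) * x)) h
      simp only [smul_val, translate_apply] at h1
      rw [← h1, pow_succ', mul_assoc, inv_mul_cancel_left]
  have hinj : Function.Injective fun n : ℕ => g ^ n * x :=
    (mul_left_injective x).comp (injective_pow_iff_not_isOfFinOrder.2 hg)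
  refine Set.infinite_range_of_injective hinj (μ.2.1.subset ?_)
  rintro _ ⟨n, rfl⟩
  simpa [hpow n] using hx

theorem exists_nhds_disjoint (hG : ∀ x : G, IsOfFinOrder x → x = 1) (μ : FiniteChain G) :
    ∃ U ∈ 𝓝 μ, ∀ g : G, ((g • ·) '' U ∩ U).Nonempty → g = 1 := by
  obtain ⟨x, hx⟩ : ∃ x, μ.1 x ≠ 0 := by
    by_contra! hx
    exact μ.2.2 (BoundedContinuousFunction.ext hx)
  -- If `g` moves a chain close to `μ` to a chain close to `μ`, then `g` belongs to the finite set
  -- `S`, on which the displacement of `μ` is bounded below.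
  let S : Set G := {g | g * x ∈ Function.support μ.1}
  have hS : S.Finite := μ.2.1.preimage (mul_left_injective x).injOn
  have hev : ∀ᶠ ε : ℝ in 𝓝[>] 0, (∀ g ∈ S, g ≠ 1 → 2 * ε < dist (g • μ).1 μ.1) ∧
      2 * ε < |μ.1 x| := by
    have hlt : ∀ c : ℝ, 0 < c → ∀ᶠ ε : ℝ in 𝓝[>] 0, 2 * ε < c := by
      intro c hc
      filter_upwards [Ioo_mem_nhdsGT (half_pos hc)] with ε hε
      linarith [hε.2]
    refine ((eventually_all_finite hS).2 fun g _ => ?_).and (hlt _ (abs_pos.2 hx))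
    by_cases hg : g = 1
    · exact Eventually.of_forall fun _ h => absurd hg h
    · have : 0 < dist (g • μ).1 μ.1 := dist_pos.2 fun h => hg (eq_one_of_smul_eq hG (Subtype.ext h))
      filter_upwards [hlt _ this] with ε hε _ using hε
  obtain ⟨ε, ⟨h1, h2⟩, hε⟩ := (hev.and self_mem_nhdsWithin).exists
  refine ⟨Subtype.val ⁻¹' Metric.ball μ.1 ε,
    continuous_subtype_val.continuousAt (Metric.ball_mem_nhds _ hε), fun g => ?_⟩
  rintro ⟨_, ⟨ν, hν, rfl⟩, hν'⟩
  have hν : dist ν.1 μ.1 < ε := hν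
  have hν' : dist (translate g ν.1) μ.1 < ε := hν'
  by_contra hg
  have hgS : g ∈ S := by
    intro h0
    have e1 := (BoundedContinuousFunction.dist_coe_le_dist (f := ν.1) (g := μ.1) x).trans_lt hν
    have e2 := (BoundedContinuousFunction.dist_coe_le_dist (f := translate g ν.1) (g := μ.1)
      (g * x)).trans_lt hν'
    rw [translate_apply, inv_mul_cancel_left, h0, Real.dist_eq, sub_zero] at e2
    rw [Real.dist_eq] at e1
    have := abs_sub_abs_le_abs_sub (μ.1 x) (ν.1 x)
    rw [abs_sub_comm] at this
    linarith
  have h3 := h1 g hgS hg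
  have h4 : dist (g • μ).1 (translate g ν.1) = dist μ.1 ν.1 := dist_translate g _ _
  have := dist_triangle (g • μ).1 (translate g ν.1) μ.1
  rw [h4, dist_comm μ.1] at this
  linarith

/-- The characteristic function of a point. -/
def point {G : Type*} [TopologicalSpace G] [DiscreteTopology G] (x : G) : G →ᵇ ℝ := by
  classical
  exact BoundedContinuousFunction.ofNormedAddCommGroupDiscrete (fun y => if y = x then 1 else 0) 1
    (fun y => by split_ifs <;> simp)

theorem point_apply_self {G : Type*} [TopologicalSpace G] [DiscreteTopology G] (x : G) :
    point x x = 1 := by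
  simp [point]

theorem point_apply_nonneg {G : Type*} [TopologicalSpace G] [DiscreteTopology G] (x y : G) :
    0 ≤ point x y := by
  simp only [point, BoundedContinuousFunction.coe_ofNormedAddCommGroupDiscrete]
  split_ifs <;> simp

theorem support_point {G : Type*} [TopologicalSpace G] [DiscreteTopology G] (x : G) :
    Function.support (point x) ⊆ {x} := by
  intro y hy
  by_contra h
  simp only [mem_singleton_iff] at h
  simp [point, h] at hy

theorem translate_point (g x : G) : translate g (point x) = point (g * x) := by
  ext y
  simp only [point, translate_apply, BoundedContinuousFunction.coe_ofNormedAddCommGroupDiscrete]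
  by_cases h : y = g * x
  · rw [if_pos h, if_pos (inv_mul_eq_iff_eq_mul.2 h)]
  · rw [if_neg h, if_neg (mt inv_mul_eq_iff_eq_mul.1 h)]

end FiniteChain

/-! ### The boundary of the polygon -/

section Polygon

/-- The two kinds of side pairings have a common description: side `k` is identified with side
`k + 2` in the reverse direction, for `k ≡ 0, 1` modulo `4`. -/
theorem polygonGluing_iff {g : ℕ} {d d' : Metric.closedBall (0 : ℂ) 1} :
    PolygonGluing g d d' ↔ ∃ k < 4 * g, (k % 4 = 0 ∨ k % 4 = 1) ∧ ∃ t ∈ Icc (0 : ℝ) 1,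
      d = polygonBoundaryPoint g (k + t) ∧ d' = polygonBoundaryPoint g (k + 3 - t) := by
  constructor
  · rintro (⟨j, hj, t, ht⟩ | ⟨j, hj, t, ht⟩)
    · exact ⟨4 * j, by omega, by omega, t, ht, by push_cast; rfl, by push_cast; rfl⟩
    · refine ⟨4 * j + 1, by omega, by omega, t, ht, by push_cast; rfl, ?_⟩
      congr 1
      push_cast
      ring
  · rintro ⟨k, hk, hk4, t, ht, rfl, rfl⟩
    rcases hk4 with hk4 | hk4
    · obtain ⟨j, rfl⟩ : ∃ j, k = 4 * j := ⟨k / 4, by omega⟩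
      have := PolygonGluing.a_side (g := g) j (by omega) t ht
      push_cast
      exact this
    · obtain ⟨j, rfl⟩ : ∃ j, k = 4 * j + 1 := ⟨k / 4, by omega⟩
      have := PolygonGluing.b_side (g := g) j (by omega) t ht
      push_cast
      convert this using 2
      ring

theorem continuous_polygonBoundaryPoint (g : ℕ) : Continuous (polygonBoundaryPoint g) := by
  unfold polygonBoundaryPoint
  fun_prop

theorem polygonBoundaryPoint_add {g : ℕ} (hg : 0 < g) (s : ℝ) :
    polygonBoundaryPoint g (s + 4 * g) = polygonBoundaryPoint g s := by
  apply Subtype.ext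
  have hg' : (g : ℝ) ≠ 0 := by positivity
  simp only [polygonBoundaryPoint]
  rw [Complex.exp_eq_exp_iff_exists_int]
  refine ⟨1, ?_⟩
  have : 2 * Real.pi * (s + 4 * g) / (4 * (g : ℝ)) = 2 * Real.pi * s / (4 * g) + 2 * Real.pi := by
    field_simp
  rw [this]
  push_cast
  ring

theorem exists_polygonBoundaryPoint_eq {g : ℕ} (hg : 0 < g) {z : Metric.closedBall (0 : ℂ) 1}
    (hz : ‖(z : ℂ)‖ = 1) :
    ∃ k < 4 * g, ∃ t ∈ Ico (0 : ℝ) 1, z = polygonBoundaryPoint g (k + t) := by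
  have hg' : (0 : ℝ) < 4 * g := by positivity
  obtain ⟨s, ⟨hs0, hs1⟩, hs⟩ : ∃ s ∈ Ico (0 : ℝ) (4 * g), z = polygonBoundaryPoint g s := by
    have hmain : z = polygonBoundaryPoint g (Complex.arg z * (4 * g) / (2 * Real.pi)) := by
      apply Subtype.ext
      simp only [polygonBoundaryPoint]
      have : 2 * Real.pi * (Complex.arg z * (4 * g) / (2 * Real.pi)) / (4 * (g : ℝ)) =
          Complex.arg z := by
        field_simp
      have h := Complex.norm_mul_exp_arg_mul_I (z : ℂ)
      rw [hz] at h
      rw [this]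
      simpa using h.symm
    have harg1 := Complex.neg_pi_lt_arg (z : ℂ)
    have harg2 := Complex.arg_le_pi (z : ℂ)
    set s := Complex.arg z * (4 * g) / (2 * Real.pi) with hs
    have hpi := Real.pi_pos
    have hs1 : s ≤ (4 * g) / 2 := by
      rw [hs, div_le_iff₀ (by positivity)]
      nlinarith
    have hs2 : -(4 * g) / 2 ≤ s := by
      rw [hs, le_div_iff₀ (by positivity)]
      nlinarith
    rcases le_or_gt 0 s with h | h
    · exact ⟨s, ⟨h, by linarith⟩, hmain⟩
    · exact ⟨s + 4 * g, ⟨by linarith, by linarith⟩, by rw [polygonBoundaryPoint_add hg, ← hmain]⟩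
  refine ⟨⌊s⌋₊, ?_, s - ⌊s⌋₊, ⟨?_, ?_⟩, ?_⟩
  · rw [Nat.floor_lt hs0]
    exact_mod_cast hs1
  · linarith [Nat.floor_le hs0]
  · linarith [Nat.lt_floor_add_one s]
  · rw [hs]
    congr 1
    ring

/-- The arc of the unit circle of signed parameter length `u` starting at parameter `s`. -/
def polygonArc (g : ℕ) (s u : ℝ) : Path (polygonBoundaryPoint g s) (polygonBoundaryPoint g (s + u))
    where
  toFun τ := polygonBoundaryPoint g (s + τ * u)
  continuous_toFun := (continuous_polygonBoundaryPoint g).comp (by fun_prop)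
  source' := by simp
  target' := by simp

theorem re_mul_conj_polygonBoundaryPoint (g : ℕ) (s u : ℝ) :
    ((polygonBoundaryPoint g s : ℂ) * (starRingEnd ℂ) (polygonBoundaryPoint g u : ℂ)).re =
      Real.cos (2 * Real.pi * (s - u) / (4 * g)) := by
  simp only [polygonBoundaryPoint]
  rw [← Complex.exp_conj, ← Complex.exp_add, map_mul, Complex.conj_ofReal, Complex.conj_I]
  have : ((2 * Real.pi * s / (4 * (g : ℝ)) : ℝ) : ℂ) * Complex.I +
      ((2 * Real.pi * u / (4 * (g : ℝ)) : ℝ) : ℂ) * -Complex.I =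
        ((2 * Real.pi * (s - u) / (4 * g) : ℝ) : ℂ) * Complex.I := by
    push_cast
    ring
  rw [this, Complex.exp_ofReal_mul_I_re]

/-- The weight of a vertex of a regular `n`-gon at a boundary point at arc parameter distance `u`:
it is positive on the two adjacent sides only. -/
def tent (n : ℕ) (u : ℝ) : ℝ :=
  max 0 (Real.cos (2 * Real.pi * u / n) - Real.cos (2 * Real.pi / n))

theorem tent_neg (n : ℕ) (u : ℝ) : tent n (-u) = tent n u := by
  unfold tent
  rw [← Real.cos_neg]
  congr 3
  ring

theorem tent_sub {n : ℕ} (hn : 0 < n) (u : ℝ) : tent n (n - u) = tent n u := by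
  unfold tent
  have : 2 * Real.pi * (n - u) / n = 2 * Real.pi - 2 * Real.pi * u / n := by
    have : (n : ℝ) ≠ 0 := by positivity
    field_simp
  rw [this, Real.cos_two_pi_sub]

theorem tent_nonneg (n : ℕ) (u : ℝ) : 0 ≤ tent n u := le_max_left _ _

theorem tent_pos {n : ℕ} (hn : 2 ≤ n) {u : ℝ} (hu : 0 ≤ u) (hu' : u < 1) : 0 < tent n u := by
  have hn' : (2 : ℝ) ≤ n := by exact_mod_cast hn
  have hpi := Real.pi_pos
  refine lt_max_of_lt_right (sub_pos.2 (Real.cos_lt_cos_of_nonneg_of_le_pi ?_ ?_ ?_))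
  · positivity
  · rw [div_le_iff₀ (by linarith)]
    nlinarith
  · rw [div_lt_div_iff_of_pos_right (by linarith)]
    nlinarith

theorem tent_eq_zero {n : ℕ} (hn : 2 ≤ n) {u : ℝ} (hu : 1 ≤ |u|) (hu' : |u| ≤ n - 1) :
    tent n u = 0 := by
  have hn' : (2 : ℝ) ≤ n := by exact_mod_cast hn
  have hpi := Real.pi_pos
  have key : ∀ u : ℝ, 1 ≤ u → u ≤ n / 2 → tent n u = 0 := by
    intro u h1 h2
    refine max_eq_left (sub_nonpos.2 (Real.cos_le_cos_of_nonneg_of_le_pi ?_ ?_ ?_))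
    · positivity
    · rw [div_le_iff₀ (by linarith)]
      nlinarith
    · rw [div_le_div_iff_of_pos_right (by linarith)]
      nlinarith
  have habs : tent n u = tent n |u| := by
    rcases abs_choice u with h | h <;> rw [h]
    rw [tent_neg]
  rw [habs]
  rcases le_total |u| (n / 2) with h | h
  · exact key _ hu h
  · rw [← tent_sub (by omega)]
    exact key _ (by linarith) (by linarith)

theorem sum_tent_smul {E : Type*} [AddCommGroup E] [Module ℝ E] {n : ℕ} (hn : 2 ≤ n) (x : ℕ → E)
    (hx : x n = x 0) {k : ℕ} (hk : k < n) {t : ℝ} (ht : t ∈ Icc (0 : ℝ) 1) :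
    ∑ l ∈ Finset.range n, tent n (k + t - l) • x l =
      tent n t • x k + tent n (1 - t) • x (k + 1) := by
  obtain ⟨ht0, ht1⟩ := ht
  have e1 : tent n (k + t - k) = tent n t := by congr 1; ring
  rcases eq_or_ne (k + 1) n with hkn | hkn
  · have hk' : (k : ℝ) = n - 1 := by rw [← hkn]; push_cast; ring
    rw [Finset.sum_eq_add_of_mem k 0 (by simpa) (by simp; omega) (by omega), e1, hkn, hx]
    · have : tent n (k + t - (0 : ℕ)) = tent n (1 - t) := by
        rw [← tent_sub (by omega) (1 - t), hk']
        congr 1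
        push_cast
        ring
      rw [this]
    · rintro l hl ⟨h1, h2⟩
      have hl' : (l : ℝ) + 1 ≤ k := by
        have := Finset.mem_range.1 hl
        exact_mod_cast (show l + 1 ≤ k by omega)
      have h2' : (1 : ℝ) ≤ l := by exact_mod_cast Nat.one_le_iff_ne_zero.2 h2
      rw [tent_eq_zero hn, zero_smul]
      · rw [abs_of_nonneg (by linarith)]; linarith
      · rw [abs_of_nonneg (by linarith)]; linarith
  · rw [Finset.sum_eq_add_of_mem k (k + 1) (by simpa) (by simp; omega) (by omega), e1]
    · have : tent n (k + t - (k + 1 : ℕ)) = tent n (1 - t) := by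
        rw [← tent_neg]
        congr 1
        push_cast
        ring
      rw [this]
    · rintro l hl ⟨h1, h2⟩
      have hln : (l : ℝ) ≤ n - 1 := by
        have := Finset.mem_range.1 hl
        rw [le_sub_iff_add_le]
        exact_mod_cast (show l + 1 ≤ n by omega)
      have hkn' : (k : ℝ) ≤ n - 2 := by
        rw [le_sub_iff_add_le]
        exact_mod_cast (show k + 2 ≤ n by omega)
      have hl0 : (0 : ℝ) ≤ l := by positivity
      have hk0 : (0 : ℝ) ≤ k := by positivity
      rcases lt_or_gt_of_ne h1 with h | h
      · have h' : (l : ℝ) + 1 ≤ k := by exact_mod_cast h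
        rw [tent_eq_zero hn, zero_smul]
        · rw [abs_of_nonneg (by linarith)]; linarith
        · rw [abs_of_nonneg (by linarith)]; linarith
      · have h' : (k : ℝ) + 2 ≤ l := by exact_mod_cast (show k + 2 ≤ l by omega)
        rw [tent_eq_zero hn, zero_smul]
        · rw [abs_of_nonpos (by linarith)]; linarith
        · rw [abs_of_nonpos (by linarith)]; linarith

/-! ### Labels of the sides -/

variable {G : Type*} [Group G]

/-- The label of side `k` in the word `∏ ⁅a j, b j⁆`. -/
def sideLabel (a b : ℕ → G) (k : ℕ) : G :=
  if k % 4 = 0 then a (k / 4) else if k % 4 = 1 then b (k / 4)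
  else if k % 4 = 2 then (a (k / 4))⁻¹ else (b (k / 4))⁻¹

/-- The product of the labels of the first `k` sides. -/
def vertexLabel (a b : ℕ → G) : ℕ → G
  | 0 => 1
  | k + 1 => vertexLabel a b k * sideLabel a b k

theorem sideLabel_add_two (a b : ℕ → G) {k : ℕ} (hk : k % 4 = 0 ∨ k % 4 = 1) :
    sideLabel a b (k + 2) = (sideLabel a b k)⁻¹ := by
  unfold sideLabel
  have e : (k + 2) / 4 = k / 4 := by omega
  rcases hk with hk | hk
  · have : (k + 2) % 4 = 2 := by omega
    simp [this, hk, e]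
  · have : (k + 2) % 4 = 3 := by omega
    simp [this, hk, e]

open scoped commutatorElement

theorem vertexLabel_four_mul (a b : ℕ → G) (n : ℕ) :
    vertexLabel a b (4 * n) = ((List.range n).map fun j => ⁅a j, b j⁆).prod := by
  induction n with
  | zero => rfl
  | succ n ih =>
    have h1 : 4 * (n + 1) = 4 * n + 1 + 1 + 1 + 1 := by ring
    rw [List.range_succ, List.map_append, List.prod_append, ← ih, h1]
    simp only [vertexLabel, List.map_cons, List.map_nil, List.prod_cons, List.prod_nil, mul_one]
    have e0 : sideLabel a b (4 * n) = a n := by simp [sideLabel]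
    have e1 : sideLabel a b (4 * n + 1) = b n := by
      have h : (4 * n + 1) % 4 = 1 := by omega
      have h' : (4 * n + 1) / 4 = n := by omega
      simp [sideLabel, h, h']
    have e2 : sideLabel a b (4 * n + 1 + 1) = (a n)⁻¹ := by
      rw [← e0]
      exact sideLabel_add_two a b (by omega)
    have e3 : sideLabel a b (4 * n + 1 + 1 + 1) = (b n)⁻¹ := by
      rw [← e1]
      exact sideLabel_add_two a b (by omega)
    rw [e0, e1, e2, e3, commutatorElement_def]
    simp only [mul_assoc]

/-- The element which moves the labels of the end points of side `k + 2`, in reverse order, to the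
labels of the end points of side `k`. -/
theorem vertexLabel_glue (a b : ℕ → G) {k : ℕ} (hk : k % 4 = 0 ∨ k % 4 = 1) :
    vertexLabel a b k * (vertexLabel a b (k + 3))⁻¹ * vertexLabel a b (k + 2) =
      vertexLabel a b (k + 1) := by
  simp only [vertexLabel, sideLabel_add_two a b hk]
  group

end Polygon

/-! ### The fundamental group of the glued polygon -/

section GluedPolygon

open scoped commutatorElement BoundedContinuousFunction

/-- The map from the disc to the finite chains of `G` which sends the vertices of the polygon to
multiples of their labels and the centre to the unit element, and which interpolates between these
values. -/
def polygonChain {G : Type*} [Group G] [TopologicalSpace G] [DiscreteTopology G] (g : ℕ)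
    (a b : ℕ → G) (z : ℂ) : G →ᵇ ℝ :=
  (∑ l ∈ Finset.range (4 * g),
    max 0 ((z * (starRingEnd ℂ) (polygonBoundaryPoint g l : ℂ)).re -
      Real.cos (2 * Real.pi / (4 * g : ℕ)) * ‖z‖) • FiniteChain.point (vertexLabel a b l)) +
  (1 - ‖z‖) • FiniteChain.point 1

section Chain

variable {G : Type*} [Group G] [TopologicalSpace G] [DiscreteTopology G] {g : ℕ} {a b : ℕ → G}

theorem continuous_polygonChain : Continuous (polygonChain g a b) := by
  unfold polygonChain
  refine Continuous.add (continuous_finsetSum _ fun l _ => ?_) ?_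
  · have h : Continuous fun z : ℂ => (z * (starRingEnd ℂ) (polygonBoundaryPoint g l : ℂ)).re -
        Real.cos (2 * Real.pi / (4 * g : ℕ)) * ‖z‖ :=
      (Complex.continuous_re.comp (continuous_id.mul continuous_const)).sub
        (continuous_const.mul continuous_norm)
    exact (continuous_const.max h).smul continuous_const
  · exact (continuous_const.sub continuous_norm).smul continuous_const

theorem polygonChain_boundary (hg : 0 < g) (hab : vertexLabel a b (4 * g) = 1) {k : ℕ}
    (hk : k < 4 * g) {t : ℝ} (ht : t ∈ Icc (0 : ℝ) 1) :
    polygonChain g a b (polygonBoundaryPoint g (k + t)) =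
      tent (4 * g) t • FiniteChain.point (vertexLabel a b k) +
        tent (4 * g) (1 - t) • FiniteChain.point (vertexLabel a b (k + 1)) := by
  have hnorm : ‖(polygonBoundaryPoint g (k + t) : ℂ)‖ = 1 := by
    simp only [polygonBoundaryPoint, Complex.norm_exp_ofReal_mul_I]
  unfold polygonChain
  rw [hnorm, sub_self, zero_smul, add_zero, ← sum_tent_smul (by omega)
    (fun l => FiniteChain.point (vertexLabel a b l)) (by simp only [hab]; rfl) hk ht]
  refine Finset.sum_congr rfl fun l _ => ?_
  rw [re_mul_conj_polygonBoundaryPoint, mul_one, tent]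
  push_cast
  rfl

theorem polygonChain_vertex (hg : 0 < g) (hab : vertexLabel a b (4 * g) = 1) {k : ℕ}
    (hk : k ≤ 4 * g) : polygonChain g a b (polygonBoundaryPoint g k) =
      tent (4 * g) 0 • FiniteChain.point (vertexLabel a b k) := by
  have h1 : tent (4 * g) 1 = 0 := by
    have : (4 : ℝ) ≤ (4 * g : ℕ) := by exact_mod_cast (show 4 ≤ 4 * g by omega)
    exact tent_eq_zero (by omega) (by simp) (by rw [abs_one]; linarith)
  rcases hk.lt_or_eq with hk | rfl
  · have h := polygonChain_boundary hg hab hk (t := 0) (by simp)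
    rwa [add_zero, sub_zero, h1, zero_smul, add_zero] at h
  · have h := polygonChain_boundary hg hab (k := 0) (by omega) (t := 0) (by simp)
    have e : polygonBoundaryPoint g (4 * g : ℕ) = polygonBoundaryPoint g (0 : ℕ) := by
      have := polygonBoundaryPoint_add hg 0
      push_cast
      simpa using this
    rw [sub_zero, h1, zero_smul, add_zero, add_zero] at h
    rw [e, h, hab]
    rfl

theorem finite_support_polygonChain (z : ℂ) : (Function.support (polygonChain g a b z)).Finite := by
  refine ((Set.finite_range fun l : Fin (4 * g) => vertexLabel a b l).insert 1).subset ?_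
  intro x hx
  by_contra hx'
  rw [mem_insert_iff, not_or] at hx'
  have h0 : ∀ y : G, x ≠ y → FiniteChain.point y x = 0 := fun y hy => by
    by_contra h
    exact hy (FiniteChain.support_point y h)
  apply hx
  unfold polygonChain
  rw [BoundedContinuousFunction.coe_add, Pi.add_apply, BoundedContinuousFunction.coe_smul]
  dsimp only
  rw [h0 1 hx'.1, smul_zero, add_zero, BoundedContinuousFunction.coe_sum, Finset.sum_apply]
  refine Finset.sum_eq_zero fun l hl => ?_
  rw [BoundedContinuousFunction.coe_smul]
  dsimp only
  rw [h0, smul_zero]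
  rintro rfl
  exact hx'.2 ⟨⟨l, Finset.mem_range.1 hl⟩, rfl⟩

theorem polygonChain_ne_zero (hg : 0 < g) (hab : vertexLabel a b (4 * g) = 1)
    (z : Metric.closedBall (0 : ℂ) 1) : polygonChain g a b z ≠ 0 := by
  intro h
  rcases (mem_closedBall_zero_iff.1 z.2).lt_or_eq with hz | hz
  · have h1 := congrArg (fun μ : G →ᵇ ℝ => μ 1) h
    simp only [polygonChain, BoundedContinuousFunction.coe_add, Pi.add_apply,
      BoundedContinuousFunction.coe_smul, BoundedContinuousFunction.coe_sum, Finset.sum_apply,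
      BoundedContinuousFunction.coe_zero, Pi.zero_apply, FiniteChain.point_apply_self,
      smul_eq_mul, mul_one] at h1
    have h2 : 0 ≤ ∑ l ∈ Finset.range (4 * g),
        max 0 (((z : ℂ) * (starRingEnd ℂ) (polygonBoundaryPoint g l : ℂ)).re -
          Real.cos (2 * Real.pi / (4 * g : ℕ)) * ‖(z : ℂ)‖) *
            FiniteChain.point (vertexLabel a b l) 1 :=
      Finset.sum_nonneg fun l _ =>
        mul_nonneg (le_max_left _ _) (FiniteChain.point_apply_nonneg _ _)
    linarith
  · obtain ⟨k, hk, t, ht, rfl⟩ := exists_polygonBoundaryPoint_eq hg hz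
    rw [polygonChain_boundary hg hab hk ⟨ht.1, ht.2.le⟩] at h
    have h1 := congrArg (fun μ : G →ᵇ ℝ => μ (vertexLabel a b k)) h
    simp only [BoundedContinuousFunction.coe_add, Pi.add_apply,
      BoundedContinuousFunction.coe_smul, BoundedContinuousFunction.coe_zero, Pi.zero_apply,
      FiniteChain.point_apply_self, smul_eq_mul, mul_one] at h1
    have h2 := tent_pos (n := 4 * g) (by omega) ht.1 ht.2
    have h3 := mul_nonneg (tent_nonneg (4 * g) (1 - t))
      (FiniteChain.point_apply_nonneg (vertexLabel a b (k + 1)) (vertexLabel a b k))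
    linarith

/-- Points identified by the gluing have chains in the same orbit. -/
theorem polygonChain_glue (hg : 0 < g) (hab : vertexLabel a b (4 * g) = 1) {k : ℕ}
    (hk : k < 4 * g) (hk4 : k % 4 = 0 ∨ k % 4 = 1) {t : ℝ} (ht : t ∈ Icc (0 : ℝ) 1) :
    polygonChain g a b (polygonBoundaryPoint g (k + t)) =
      FiniteChain.translate (vertexLabel a b k * (vertexLabel a b (k + 3))⁻¹)
        (polygonChain g a b (polygonBoundaryPoint g (k + 3 - t))) := by
  have e : (k : ℝ) + 3 - t = (k + 2 : ℕ) + (1 - t) := by push_cast; ring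
  rw [e, polygonChain_boundary hg hab hk ht, polygonChain_boundary hg hab (k := k + 2) (by omega)
    ⟨by linarith [ht.2], by linarith [ht.1]⟩]
  have hadd : ∀ (x : G) (c c' : ℝ) (μ ν : G →ᵇ ℝ), FiniteChain.translate x (c • μ + c' • ν) =
      c • FiniteChain.translate x μ + c' • FiniteChain.translate x ν := fun _ _ _ _ _ => rfl
  rw [hadd, FiniteChain.translate_point, FiniteChain.translate_point, vertexLabel_glue a b hk4,
    inv_mul_cancel_right, sub_sub_cancel, add_comm]

end Chain

variable {X : Type*} [TopologicalSpace X] {g : ℕ}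
  {q : C(Metric.closedBall (0 : ℂ) 1, X)}

local notation "pt" => polygonBoundaryPoint

instance : SimplyConnectedSpace (Metric.closedBall (0 : ℂ) 1) :=
  have : ContractibleSpace (Metric.closedBall (0 : ℂ) 1) :=
    (convex_closedBall (0 : ℂ) 1).contractibleSpace ⟨0, by simp⟩
  SimplyConnectedSpace.ofContractible _

/-- Nearby points of a ball are joined by short paths. -/
theorem exists_nhds_path_closedBall (d : Metric.closedBall (0 : ℂ) 1)
    (U : Set (Metric.closedBall (0 : ℂ) 1)) (hU : U ∈ 𝓝 d) :
    ∃ V ∈ 𝓝 d, ∀ d' ∈ V, ∃ γ : Path d' d, range γ ⊆ U := by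
  obtain ⟨ε, hε, hb⟩ := Metric.mem_nhds_iff.1 hU
  refine ⟨Metric.ball d ε, Metric.ball_mem_nhds d hε, fun d' hd' => ?_⟩
  have hmem : ∀ t : I, AffineMap.lineMap (d' : ℂ) (d : ℂ) (t : ℝ) ∈ Metric.closedBall (0 : ℂ) 1 :=
    fun t => (convex_closedBall (0 : ℂ) 1).lineMap_mem d'.2 d.2 t.2
  refine ⟨⟨⟨fun t => ⟨AffineMap.lineMap (d' : ℂ) (d : ℂ) (t : ℝ), hmem t⟩, ?_⟩, ?_, ?_⟩, ?_⟩
  · refine Continuous.subtype_mk ?_ _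
    exact AffineMap.lineMap_continuous.comp continuous_subtype_val
  · simp
  · simp
  · rintro _ ⟨t, rfl⟩
    apply hb
    change dist (AffineMap.lineMap (d' : ℂ) (d : ℂ) (t : ℝ)) (d : ℂ) < ε
    have hd'' : dist (d' : ℂ) d < ε := hd'
    rw [dist_lineMap_right]
    refine lt_of_le_of_lt ?_ hd''
    refine mul_le_of_le_one_left dist_nonneg ?_
    rw [Real.norm_eq_abs, abs_le]
    constructor <;> linarith [t.2.1, t.2.2]

variable (hglue : ∀ d d', q d = q d' ↔ Relation.EqvGen (PolygonGluing g) d d')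
include hglue

theorem map_side_eq {k : ℕ} (hk : k < 4 * g) (hk4 : k % 4 = 0 ∨ k % 4 = 1) {t : ℝ}
    (ht : t ∈ Icc (0 : ℝ) 1) : q (pt g (k + t)) = q (pt g (k + 3 - t)) :=
  (hglue _ _).2 (Relation.EqvGen.rel _ _ (polygonGluing_iff.2 ⟨k, hk, hk4, t, ht, rfl, rfl⟩))

theorem map_vertex_add_three {k : ℕ} (hk : k < 4 * g) (hk4 : k % 4 = 0 ∨ k % 4 = 1) :
    q (pt g k) = q (pt g (k + 3 : ℕ)) := by
  have := map_side_eq hglue hk hk4 (t := 0) (by simp)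
  push_cast
  simpa using this

theorem map_vertex_add_one {k : ℕ} (hk : k < 4 * g) (hk4 : k % 4 = 0 ∨ k % 4 = 1) :
    q (pt g (k + 1 : ℕ)) = q (pt g (k + 2 : ℕ)) := by
  have := map_side_eq hglue hk hk4 (t := 1) (by simp)
  push_cast
  convert this using 3
  ring

/-- All the vertices of the polygon are identified. -/
theorem map_vertex (k : ℕ) (hk : k ≤ 4 * g) : q (pt g k) = q (pt g 0) := by
  have hblock : ∀ j < g, q (pt g (4 * j : ℕ)) = q (pt g (4 * j + 3 : ℕ)) ∧
      q (pt g (4 * j + 2 : ℕ)) = q (pt g (4 * j + 3 : ℕ)) ∧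
      q (pt g (4 * j + 1 : ℕ)) = q (pt g (4 * j + 3 : ℕ)) ∧
      q (pt g (4 * j + 4 : ℕ)) = q (pt g (4 * j + 3 : ℕ)) := by
    intro j hj
    have h1 := map_vertex_add_three hglue (k := 4 * j) (by omega) (by omega)
    have h2 := map_vertex_add_one hglue (k := 4 * j) (by omega) (by omega)
    have h3 := map_vertex_add_three hglue (k := 4 * j + 1) (by omega) (by omega)
    have h4 := map_vertex_add_one hglue (k := 4 * j + 1) (by omega) (by omega)
    exact ⟨h1, h4, h2.trans h4, h3.symm.trans (h2.trans h4)⟩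
  have h4 : ∀ j ≤ g, q (pt g (4 * j : ℕ)) = q (pt g 0) := by
    intro j
    induction j with
    | zero => simp
    | succ j ih =>
      intro hj
      obtain ⟨h1, -, -, h4⟩ := hblock j (by omega)
      rw [← ih (by omega), h1, ← h4]
      rfl
  rcases hk.lt_or_eq with hk | rfl
  · obtain ⟨h1, h2, h3, -⟩ := hblock (k / 4) (by omega)
    have h0 := h4 (k / 4) (by omega)
    have hcases : k = 4 * (k / 4) ∨ k = 4 * (k / 4) + 1 ∨ k = 4 * (k / 4) + 2 ∨
      k = 4 * (k / 4) + 3 := by omega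
    rcases hcases with h | h | h | h <;> rw [h, ← h0, h1]
    · exact h3
    · exact h2
  · exact h4 g le_rfl

variable (q) in
omit hglue in
/-- The loop formed by the first `k` sides of the polygon. The value is only meaningful when vertex
`k` is identified with vertex `0`, which is the case for all `k ≤ 4 * g`. -/
def vertexLoop (g k : ℕ) : (FundamentalGroup X (q (pt g 0)))ᵐᵒᵖ :=
  open scoped Classical in
  if h : q (pt g k) = q (pt g 0) then transition (pt g 0) h else 1

theorem vertexLoop_eq {k : ℕ} (hk : k ≤ 4 * g) :
    vertexLoop q g k = transition (pt g 0) (map_vertex hglue k hk) := by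
  rw [vertexLoop, dif_pos]

/-- The transition between two identified sides is constant along the sides. -/
theorem transition_side {k : ℕ} (hk : k < 4 * g) (hk4 : k % 4 = 0 ∨ k % 4 = 1) {t : ℝ}
    (ht : t ∈ Icc (0 : ℝ) 1) :
    transition (pt g 0) (map_side_eq hglue hk hk4 ht) =
      transition (pt g 0) (map_vertex_add_three hglue hk hk4) := by
  have hs : (k : ℝ) + 3 - t = (k + 3 : ℕ) + -t := by push_cast; ring
  have key := transition_eq_of_paths (q := q) (pt g 0) (polygonArc g k t)
    (polygonArc g (k + 3 : ℕ) (-t)) (fun τ => ?_) (map_vertex_add_three hglue hk hk4)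
    (by rw [← hs]; exact map_side_eq hglue hk hk4 ht)
  · rw [← key]
    exact transition_congr _ rfl (by rw [hs]) _ _
  · have := map_side_eq hglue hk hk4 (t := τ * t)
      ⟨mul_nonneg τ.2.1 ht.1, mul_le_one₀ τ.2.2 ht.1 ht.2⟩
    change q (pt g (k + τ * t)) = q (pt g ((k + 3 : ℕ) + τ * -t))
    rw [this]
    congr 2
    push_cast
    ring

theorem transition_side_eq_vertexLoop {k : ℕ} (hk : k + 3 ≤ 4 * g) (hk4 : k % 4 = 0 ∨ k % 4 = 1)
    {t : ℝ} (ht : t ∈ Icc (0 : ℝ) 1) :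
    transition (pt g 0) (map_side_eq hglue (by omega) hk4 ht) =
      vertexLoop q g k * (vertexLoop q g (k + 3))⁻¹ := by
  rw [transition_side hglue (by omega) hk4 ht, vertexLoop_eq hglue (by omega),
    vertexLoop_eq hglue hk, ← transition_symm, transition_mul]

theorem vertexLoop_mul_inv {k : ℕ} (hk : k + 3 ≤ 4 * g) (hk4 : k % 4 = 0 ∨ k % 4 = 1) :
    vertexLoop q g k * (vertexLoop q g (k + 3))⁻¹ =
      vertexLoop q g (k + 1) * (vertexLoop q g (k + 2))⁻¹ := by
  rw [← transition_side_eq_vertexLoop hglue hk hk4 (t := 1) (by simp),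
    vertexLoop_eq hglue (by omega), vertexLoop_eq hglue (k := k + 2) (by omega), ← transition_symm,
    transition_mul]
  refine transition_congr _ ?_ ?_ _ _ <;> congr 1 <;> push_cast <;> ring

/-- The fundamental group of the glued polygon, with the classes of the sides as generators. The
torsion-free groups in which the relation holds act freely on their finite chains, to which
the disc is mapped by `polygonChain`. -/
theorem isSurfaceGroup_of_polygon [T2Space X] (hg : 0 < g) (hq : IsQuotientMap q)
    (hX : ∀ x : X, ∃ O ∈ 𝓝 x, ∀ (y z : X) (γ γ' : Path y z), range γ ⊆ O → range γ' ⊆ O →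
      γ.Homotopic γ') :
    IsSurfaceGroup g
      (fun j => (vertexLoop q g (4 * j))⁻¹ * vertexLoop q g (4 * j + 1))
      (fun j => (vertexLoop q g (4 * j + 1))⁻¹ * vertexLoop q g (4 * j + 2)) := by
  set E := vertexLoop q g with hE
  set s := fun j => (E (4 * j))⁻¹ * E (4 * j + 1) with hs
  set t := fun j => (E (4 * j + 1))⁻¹ * E (4 * j + 2) with ht
  have hE0 : E 0 = 1 := by
    rw [hE, vertexLoop_eq hglue (by omega)]
    exact (transition_congr _ (by simp) rfl _ _).trans (transition_self _ (pt g 0))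
  have hE4 : E (4 * g) = 1 := by
    rw [hE, vertexLoop_eq hglue le_rfl]
    refine (transition_congr _ ?_ rfl _ _).trans (transition_self _ (pt g 0))
    have := polygonBoundaryPoint_add hg 0
    push_cast
    simpa using this
  have hstep : ∀ j < g, E (4 * j + 1) = E (4 * j) * s j ∧ E (4 * j + 2) = E (4 * j + 1) * t j ∧
      E (4 * j + 3) = E (4 * j + 2) * (s j)⁻¹ ∧ E (4 * j + 4) = E (4 * j + 3) * (t j)⁻¹ := by
    intro j hj
    have h1 := vertexLoop_mul_inv hglue (k := 4 * j) (by omega) (by omega)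
    have h2 := vertexLoop_mul_inv hglue (k := 4 * j + 1) (by omega) (by omega)
    refine ⟨by simp [hs], by simp [ht], ?_, ?_⟩
    · rw [← inv_inj, mul_inv_rev, inv_inv]
      simp only [hs]
      rw [mul_assoc, ← h1, inv_mul_cancel_left]
    · rw [← inv_inj, mul_inv_rev, inv_inv]
      simp only [ht]
      rw [mul_assoc]
      exact (inv_mul_eq_iff_eq_mul.2 h2.symm).symm
  have hvertex : ∀ j ≤ g, E (4 * j) = vertexLabel s t (4 * j) := by
    intro j
    induction j with
    | zero => intro; exact hE0
    | succ j ih =>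
      intro hj
      obtain ⟨h1, h2, h3, h4⟩ := hstep j (by omega)
      have e : E (4 * (j + 1)) = E (4 * j) * ⁅s j, t j⁆ := by
        change E (4 * j + 4) = _
        rw [h4, h3, h2, h1, commutatorElement_def]
        simp only [mul_assoc]
      rw [e, ih (by omega), vertexLabel_four_mul, vertexLabel_four_mul, List.range_succ]
      simp
  refine ⟨?_, ?_, ?_⟩
  · -- The transition loops are words in the sides.
    set N := Subgroup.closure {x | ∃ j < g, x = s j ∨ x = t j} with hN
    have hsN : ∀ j < g, s j ∈ N := fun j hj => Subgroup.subset_closure ⟨j, hj, Or.inl rfl⟩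
    have htN : ∀ j < g, t j ∈ N := fun j hj => Subgroup.subset_closure ⟨j, hj, Or.inr rfl⟩
    have hblock : ∀ j < g, E (4 * j) ∈ N → E (4 * j + 1) ∈ N ∧ E (4 * j + 2) ∈ N ∧
        E (4 * j + 3) ∈ N ∧ E (4 * j + 4) ∈ N := by
      intro j hj h0
      obtain ⟨h1, h2, h3, h4⟩ := hstep j hj
      have m1 : E (4 * j + 1) ∈ N := h1 ▸ mul_mem h0 (hsN j hj)
      have m2 : E (4 * j + 2) ∈ N := h2 ▸ mul_mem m1 (htN j hj)
      have m3 : E (4 * j + 3) ∈ N := h3 ▸ mul_mem m2 (inv_mem (hsN j hj))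
      exact ⟨m1, m2, m3, h4 ▸ mul_mem m3 (inv_mem (htN j hj))⟩
    have h4N : ∀ j ≤ g, E (4 * j) ∈ N := by
      intro j
      induction j with
      | zero => intro; rw [mul_zero, hE0]; exact one_mem N
      | succ j ih => exact fun hj => (hblock j (by omega) (ih (by omega))).2.2.2
    have hEN : ∀ k ≤ 4 * g, E k ∈ N := by
      intro k hk
      rcases hk.lt_or_eq with hk | rfl
      · obtain ⟨m1, m2, m3, -⟩ := hblock (k / 4) (by omega) (h4N _ (by omega))
        have hcases : k = 4 * (k / 4) ∨ k = 4 * (k / 4) + 1 ∨ k = 4 * (k / 4) + 2 ∨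
          k = 4 * (k / 4) + 3 := by omega
        rcases hcases with h | h | h | h <;> rw [h]
        exacts [h4N _ (by omega), m1, m2, m3]
      · exact h4N g le_rfl
    have hgen : ∀ d d', PolygonGluing g d d' → ∀ h : q d = q d', transition (pt g 0) h ∈ N := by
      rintro d d' hdd' h
      obtain ⟨k, hk, hk4, τ, hτ, rfl, rfl⟩ := polygonGluing_iff.1 hdd'
      have := transition_side_eq_vertexLoop hglue (k := k) (by omega) hk4 hτ
      rw [this]
      exact mul_mem (hEN _ (by omega)) (inv_mem (hEN _ (by omega)))
    refine eq_top_of_transition_mem (pt g 0) hq.surjective exists_nhds_path_closedBall hX N ?_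
    intro d d' h
    have hE := (hglue d d').1 h
    induction hE with
    | rel d d' hdd' => exact hgen d d' hdd' h
    | refl d => rw [transition_self]; exact one_mem N
    | symm d d' hdd' ih =>
      rw [transition_symm _ h.symm]
      exact inv_mem (ih h.symm)
    | trans d d' d'' h1 h2 ih1 ih2 =>
      have h1' := (hglue _ _).2 h1
      have h2' := (hglue _ _).2 h2
      rw [← transition_mul _ h1' h2']
      exact mul_mem (ih1 h1') (ih2 h2')
  · rw [← vertexLabel_four_mul, ← hvertex g le_rfl, hE4]
  · intro G _ hG a b hab
    let _ : TopologicalSpace G := ⊥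
    have : DiscreteTopology G := ⟨rfl⟩
    rw [← vertexLabel_four_mul] at hab
    let f : C(Metric.closedBall (0 : ℂ) 1, FiniteChain G) :=
      ⟨fun z => ⟨polygonChain g a b z, finite_support_polygonChain _,
        polygonChain_ne_zero hg hab z⟩,
        Continuous.subtype_mk (continuous_polygonChain.comp continuous_subtype_val) _⟩
    have hside : ∀ d d', PolygonGluing g d d' → ∃ x : G, f d = x • f d' := by
      rintro d d' hdd'
      obtain ⟨k, hk, hk4, τ, hτ, rfl, rfl⟩ := polygonGluing_iff.1 hdd'
      exact ⟨_, Subtype.ext (polygonChain_glue hg hab hk hk4 hτ)⟩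
    have hf : ∀ d d', q d = q d' → ∃ x : G, f d = x • f d' := by
      intro d d' h
      have hE := (hglue d d').1 h
      clear h
      induction hE with
      | rel d d' hdd' => exact hside d d' hdd'
      | refl d => exact ⟨1, (one_smul _ _).symm⟩
      | symm d d' _ ih =>
        obtain ⟨x, hx⟩ := ih
        exact ⟨x⁻¹, by rw [hx, inv_smul_smul]⟩
      | trans d d' d'' _ _ ih1 ih2 =>
        obtain ⟨x, hx⟩ := ih1
        obtain ⟨y, hy⟩ := ih2
        exact ⟨x * y, by rw [hx, hy, mul_smul]⟩
    obtain ⟨Λ, hΛ⟩ := exists_hom_of_equivariant hq (pt g 0)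
      (FiniteChain.exists_nhds_disjoint hG) f hf
    have hΛE : ∀ k ≤ 4 * g, Λ (E k) = vertexLabel a b k := by
      intro k hk
      rw [hE, vertexLoop_eq hglue hk]
      refine hΛ _ _ _ _ (Subtype.ext ?_)
      change polygonChain g a b (pt g k) =
        FiniteChain.translate (vertexLabel a b k) (polygonChain g a b (pt g 0))
      have hv0 := polygonChain_vertex hg hab (k := 0) (by omega)
      rw [Nat.cast_zero] at hv0
      rw [polygonChain_vertex hg hab hk, hv0]
      have hsm : ∀ (x : G) (c : ℝ) (μ : G →ᵇ ℝ), FiniteChain.translate x (c • μ) =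
        c • FiniteChain.translate x μ := fun _ _ _ => rfl
      rw [hsm, FiniteChain.translate_point]
      simp [vertexLabel]
    refine ⟨Λ, fun j hj => ⟨?_, ?_⟩⟩
    · simp only [hs]
      rw [map_mul, map_inv, hΛE _ (by omega), hΛE _ (by omega), vertexLabel, inv_mul_cancel_left]
      simp [sideLabel]
    · simp only [ht]
      rw [map_mul, map_inv, hΛE _ (by omega), hΛE _ (by omega)]
      change _ * (vertexLabel a b (4 * j + 1) * sideLabel a b (4 * j + 1)) = _
      rw [inv_mul_cancel_left]
      have h : (4 * j + 1) % 4 = 1 := by omega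
      have h' : (4 * j + 1) / 4 = j := by omega
      simp [sideLabel, h, h']

end GluedPolygon

/-! ### Local contractibility of flat surfaces -/

section FlatLocal

theorem Path.homotopic_of_range_subset {X : Type*} [TopologicalSpace X] {O : Set X}
    [SimplyConnectedSpace O] {y z : X} (γ γ' : Path y z) (h : range γ ⊆ O) (h' : range γ' ⊆ O) :
    γ.Homotopic γ' := by
  have hy : y ∈ O := by simpa using h ⟨0, rfl⟩
  have hz : z ∈ O := by simpa using h ⟨1, rfl⟩
  let δ : Path (⟨y, hy⟩ : O) ⟨z, hz⟩ :=
    ⟨⟨fun t => ⟨γ t, h ⟨t, rfl⟩⟩, γ.continuous.subtype_mk _⟩, by simp, by simp⟩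
  let δ' : Path (⟨y, hy⟩ : O) ⟨z, hz⟩ :=
    ⟨⟨fun t => ⟨γ' t, h' ⟨t, rfl⟩⟩, γ'.continuous.subtype_mk _⟩, by simp, by simp⟩
  exact (SimplyConnectedSpace.paths_homotopic δ δ').map ⟨Subtype.val, continuous_subtype_val⟩

theorem coneDist_mul {θ l : ℝ} (hl : 0 ≤ l) (r s : ℝ) (t u : AddCircle θ) :
    coneDist θ (l * r) t (l * s) u = l * coneDist θ r t s u := by
  unfold coneDist
  rw [← Real.sqrt_sq hl, ← Real.sqrt_mul (sq_nonneg l), Real.sqrt_sq hl]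
  congr 1
  ring

theorem coneDist_self_angle (θ r s : ℝ) (t : AddCircle θ) : coneDist θ r t s t = |r - s| := by
  unfold coneDist
  rw [sub_self, norm_zero, min_eq_right Real.pi_pos.le, Real.cos_zero, ← Real.sqrt_sq_eq_abs]
  congr 1
  ring

variable {X : Type*} [MetricSpace X]

/-- A conical ball is contracted to its tip along the rays. -/
theorem IsConePoint.exists_contractible_ball {θ : ℝ} {x : X} (h : IsConePoint θ x) :
    ∃ R > 0, ContractibleSpace (Metric.ball x R) := by
  obtain ⟨R, hR, P, hP0, hPs, hPd⟩ := h
  refine ⟨R, hR, ?_⟩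
  choose! r hr t ht using hPs
  have hdist : ∀ l ∈ Icc (0 : ℝ) 1, ∀ y ∈ Metric.ball x R,
      dist (P (l * r y) (t y)) x = l * r y := by
    intro l hl y hy
    have h1 : l * r y ∈ Ico 0 R := ⟨mul_nonneg hl.1 (hr y hy).1,
      (mul_le_of_le_one_left (hr y hy).1 hl.2).trans_lt (hr y hy).2⟩
    rw [← hP0 (t y), hPd _ h1 _ ⟨le_rfl, hR⟩, coneDist_self_angle, sub_zero, abs_of_nonneg h1.1]
  have hmem : ∀ l ∈ Icc (0 : ℝ) 1, ∀ y ∈ Metric.ball x R, l * r y ∈ Ico 0 R := fun l hl y hy =>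
    ⟨mul_nonneg hl.1 (hr y hy).1, (mul_le_of_le_one_left (hr y hy).1 hl.2).trans_lt (hr y hy).2⟩
  have hI : ∀ τ : I, 1 - (τ : ℝ) ∈ Icc (0 : ℝ) 1 := fun τ =>
    ⟨by linarith [τ.2.2], by linarith [τ.2.1]⟩
  let H : I × Metric.ball x R → Metric.ball x R := fun p =>
    ⟨P ((1 - (p.1 : ℝ)) * r p.2) (t p.2), by
      rw [Metric.mem_ball, hdist _ (hI p.1) _ p.2.2]
      exact (hmem _ (hI p.1) _ p.2.2).2⟩
  have hH : LipschitzWith (Real.toNNReal (1 + R)) H := by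
    refine LipschitzWith.of_dist_le_mul ?_
    rintro ⟨τ, y, hy⟩ ⟨τ', y', hy'⟩
    rw [Real.coe_toNNReal _ (by linarith)]
    have h1 : dist (P ((1 - (τ : ℝ)) * r y) (t y)) (P ((1 - (τ : ℝ)) * r y') (t y')) ≤
        dist y y' := by
      rw [hPd _ (hmem _ (hI τ) y hy) _ (hmem _ (hI τ) y' hy'), coneDist_mul (hI τ).1,
        ← hPd _ (hr y hy) _ (hr y' hy'), ht y hy, ht y' hy']
      exact mul_le_of_le_one_left dist_nonneg (hI τ).2
    have h2 : dist (P ((1 - (τ : ℝ)) * r y') (t y')) (P ((1 - (τ' : ℝ)) * r y') (t y')) ≤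
        R * dist τ τ' := by
      rw [hPd _ (hmem _ (hI τ) y' hy') _ (hmem _ (hI τ') y' hy'), coneDist_self_angle, ← sub_mul,
        abs_mul, abs_of_nonneg (hr y' hy').1, mul_comm]
      refine mul_le_mul (hr y' hy').2.le ?_ (abs_nonneg _) hR.le
      rw [Subtype.dist_eq, Real.dist_eq, abs_sub_comm]
      apply le_of_eq
      congr 1
      ring
    have h3 : dist y y' ≤ dist ((τ, ⟨y, hy⟩) : I × Metric.ball x R) (τ', ⟨y', hy'⟩) :=
      le_max_right _ _
    have h4 : dist τ τ' ≤ dist ((τ, ⟨y, hy⟩) : I × Metric.ball x R) (τ', ⟨y', hy'⟩) :=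
      le_max_left _ _
    calc dist (P ((1 - (τ : ℝ)) * r y) (t y)) (P ((1 - (τ' : ℝ)) * r y') (t y')) ≤ _ :=
          dist_triangle _ (P ((1 - (τ : ℝ)) * r y') (t y')) _
      _ ≤ dist y y' + R * dist τ τ' := add_le_add h1 h2
      _ ≤ _ := by
        rw [add_mul, one_mul]
        exact add_le_add h3 (mul_le_mul_of_nonneg_left h4 hR.le)
  rw [contractible_iff_id_nullhomotopic]
  refine ⟨⟨x, Metric.mem_ball_self hR⟩, ⟨⟨⟨H, hH.continuous⟩, fun y => ?_, fun y => ?_⟩⟩⟩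
  · apply Subtype.ext
    change P ((1 - ((0 : I) : ℝ)) * r y) (t y) = y
    rw [Set.Icc.coe_zero, sub_zero, one_mul, ht _ y.2]
  · apply Subtype.ext
    change P ((1 - ((1 : I) : ℝ)) * r y) (t y) = x
    rw [Set.Icc.coe_one, sub_self, zero_mul, hP0]

theorem OpenPartialHomeomorph.exists_contractible_nhds {Y : Type*} [TopologicalSpace Y]
    (φ : OpenPartialHomeomorph Y ℂ) {x : Y} (hx : x ∈ φ.source) :
    ∃ O ∈ 𝓝 x, ContractibleSpace O := by
  obtain ⟨ρ, hρ, hb⟩ := Metric.isOpen_iff.1 φ.open_target (φ x) (φ.map_source hx)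
  refine ⟨φ.symm '' Metric.ball (φ x) ρ, ?_, ?_⟩
  · have := φ.symm.image_mem_nhds (φ.map_source hx) (Metric.ball_mem_nhds (φ x) hρ)
    rwa [φ.left_inv hx] at this
  · have : ContractibleSpace (Metric.ball (φ x) ρ) :=
      (convex_ball (φ x) ρ).contractibleSpace ⟨φ x, Metric.mem_ball_self hρ⟩
    exact (φ.symm.homeomorphOfImageSubsetSource (s := Metric.ball (φ x) ρ) hb rfl).symm
      |>.contractibleSpace

theorem FlatSurface.exists_nhds_homotopic (S : FlatSurface X) (x : X) :
    ∃ O ∈ 𝓝 x, ∀ (y z : X) (γ γ' : Path y z), range γ ⊆ O → range γ' ⊆ O → γ.Homotopic γ' := by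
  obtain ⟨O, hO, hc⟩ : ∃ O ∈ 𝓝 x, ContractibleSpace O := by
    by_cases hx : x ∈ S.sing
    · obtain ⟨k, -, hk⟩ := S.cone_angle x hx
      obtain ⟨R, hR, hc⟩ := hk.exists_contractible_ball
      exact ⟨_, Metric.ball_mem_nhds x hR, hc⟩
    · obtain ⟨φ, -, hφ⟩ := S.cover x hx
      exact φ.exists_contractible_nhds hφ
  exact ⟨O, hO, fun y z γ γ' h h' => Path.homotopic_of_range_subset γ γ' h h'⟩

end FlatLocal

/-! ### Free semigroups in the fundamental group of a flat surface -/

section FlatFundamentalGroup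

variable {X : Type*} [MetricSpace X]

theorem op_wordEval {G : Type*} [Group G] (x y : G) (w : List Bool) :
    MulOpposite.op (wordEval x y w) =
      wordEval (MulOpposite.op x) (MulOpposite.op y) w.reverse := by
  unfold wordEval
  rw [MulOpposite.op_list_prod, List.map_map, List.map_reverse]
  congr 2
  refine List.map_congr_left fun b _ => ?_
  cases b <;> rfl

theorem FlatSurface.mem_zpowers_or_wordEval_injective (S : FlatSurface X) {g : ℕ} (hg : 2 ≤ g)
    (hX : IsClosedSurfaceOfGenus X g) {p : X} (α β : FundamentalGroup X p) :
    (∃ c, α ∈ Subgroup.zpowers c ∧ β ∈ Subgroup.zpowers c) ∨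
      Function.Injective (wordEval α β) := by
  obtain ⟨e⟩ := hX
  let q : C(Metric.closedBall (0 : ℂ) 1, X) :=
    ⟨fun d => e.symm (Quot.mk _ d), e.symm.continuous.comp continuous_quot_mk⟩
  have hq : IsQuotientMap q := e.symm.isQuotientMap.comp isQuotientMap_quot_mk
  have hglue : ∀ d d', q d = q d' ↔ Relation.EqvGen (PolygonGluing g) d d' := fun d d' =>
    e.symm.injective.eq_iff.trans ⟨Quot.eqvGen_exact, Quot.eqvGen_sound⟩
  have hgroup := isSurfaceGroup_of_polygon hglue (by omega) hq S.exists_nhds_homotopic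
  have : PathConnectedSpace X := hq.surjective.pathConnectedSpace q.continuous
  let θ : FundamentalGroup X p ≃* FundamentalGroup X (q (polygonBoundaryPoint g 0)) :=
    FundamentalGroup.fundamentalGroupMulEquivOfPathConnected _ _
  rcases hgroup.mem_zpowers_or_wordEval_injective hg (MulOpposite.op (θ α))
    (MulOpposite.op (θ β)) with ⟨c, ⟨k, hk⟩, ⟨l, hl⟩⟩ | h
  · have hz : ∀ (k : ℤ) (ξ : FundamentalGroup X p), c ^ k = MulOpposite.op (θ ξ) →
        (θ.symm c.unop) ^ k = ξ := by
      intro k ξ h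
      rw [← map_zpow, ← MulOpposite.unop_zpow, h, MulOpposite.unop_op, MulEquiv.symm_apply_apply]
    exact Or.inl ⟨θ.symm c.unop, ⟨k, hz k α hk⟩, ⟨l, hz l β hl⟩⟩
  · refine Or.inr fun w₁ w₂ hw => List.reverse_injective (h ?_)
    rw [← op_wordEval, ← op_wordEval]
    congr 1
    have e : ∀ w, wordEval (θ α) (θ β) w = θ (wordEval α β w) := fun w =>
      (map_wordEval θ.toMonoidHom α β w).symm
    rw [e, e, hw]

end FlatFundamentalGroup

/-! ### Counting words -/

section Counting

/-- The length of a word whose letters `true`, `false` have lengths `a`, `b`. -/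
def wordLength (a b : ℝ) (w : List Bool) : ℝ := (w.map fun x => cond x a b).sum

@[simp] theorem wordLength_nil (a b : ℝ) : wordLength a b [] = 0 := rfl

@[simp] theorem wordLength_cons (a b : ℝ) (x : Bool) (w : List Bool) :
    wordLength a b (x :: w) = cond x a b + wordLength a b w := by
  simp [wordLength]

theorem wordLength_nonneg {a b : ℝ} (ha : 0 ≤ a) (hb : 0 ≤ b) (w : List Bool) :
    0 ≤ wordLength a b w := by
  induction w with
  | nil => simp
  | cons x w ih => cases x <;> simp <;> positivity

/-- The free semigroup on letters of lengths `a ≤ b` has exponential growth of rate at least `h` if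
`e^{-ha} + e^{-hb} ≥ 1`, since the number `N R` of words of length at most `R` satisfies
`N R ≥ N (R - a) + N (R - b)`. -/
theorem exists_finset_wordLength_le {a b h : ℝ} (ha : 0 < a) (hab : a ≤ b) (hh : 0 ≤ h)
    (hsum : 1 ≤ Real.exp (-(h * a)) + Real.exp (-(h * b))) (R : ℝ) (hR : 0 ≤ R) :
    ∃ s : Finset (List Bool), (∀ w ∈ s, wordLength a b w ≤ R) ∧
      Real.exp (h * (R - b)) ≤ s.card := by
  classical
  suffices H : ∀ (n : ℕ) (R : ℝ), 0 ≤ R → R ≤ n * a → ∃ s : Finset (List Bool),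
      (∀ w ∈ s, wordLength a b w ≤ R) ∧ Real.exp (h * (R - b)) ≤ s.card by
    obtain ⟨n, hn⟩ := exists_nat_ge (R / a)
    exact H n R hR ((div_le_iff₀ ha).1 hn)
  have hsmall : ∀ R : ℝ, 0 ≤ R → R ≤ b → ∃ s : Finset (List Bool),
      (∀ w ∈ s, wordLength a b w ≤ R) ∧ Real.exp (h * (R - b)) ≤ s.card := by
    intro R hR hRb
    refine ⟨{[]}, by simpa using hR, ?_⟩
    simpa using mul_nonpos_of_nonneg_of_nonpos hh (by linarith)
  intro n
  induction n with
  | zero =>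
    intro R hR hR'
    exact hsmall R hR (by simp at hR'; linarith)
  | succ n ih =>
    intro R hR hRn
    rcases le_total R b with hRb | hRb
    · exact hsmall R hR hRb
    · push_cast at hRn
      obtain ⟨s, hs, hsc⟩ := ih (R - a) (by linarith) (by linarith)
      obtain ⟨s', hs', hsc'⟩ := ih (R - b) (by linarith) (by linarith)
      refine ⟨s.image (List.cons true) ∪ s'.image (List.cons false), ?_, ?_⟩
      · intro w hw
        rcases Finset.mem_union.1 hw with hw | hw
        · obtain ⟨v, hv, rfl⟩ := Finset.mem_image.1 hw
          have := hs v hv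
          simp only [wordLength_cons, cond_true]
          linarith
        · obtain ⟨v, hv, rfl⟩ := Finset.mem_image.1 hw
          have := hs' v hv
          simp only [wordLength_cons, cond_false]
          linarith
      · rw [Finset.card_union_of_disjoint, Finset.card_image_of_injective _ List.cons_injective,
          Finset.card_image_of_injective _ List.cons_injective]
        · push_cast
          refine le_trans ?_ (add_le_add hsc hsc')
          have e1 : h * (R - a - b) = h * (R - b) + -(h * a) := by ring
          have e2 : h * (R - b - b) = h * (R - b) + -(h * b) := by ring
          rw [e1, e2, Real.exp_add, Real.exp_add, ← mul_add]
          exact le_mul_of_one_le_right (Real.exp_pos _).le hsum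
        · rw [Finset.disjoint_left]
          intro w hw hw'
          obtain ⟨v, -, rfl⟩ := Finset.mem_image.1 hw
          obtain ⟨v', -, hv'⟩ := Finset.mem_image.1 hw'
          simp at hv'

theorem one_le_exp_add_exp_of_log_two {a b : ℝ} (ha : 0 < a) (hab : a ≤ b) :
    1 ≤ Real.exp (-(Real.log 2 / b * a)) + Real.exp (-(Real.log 2 / b * b)) := by
  have hb : 0 < b := ha.trans_le hab
  have h2 : (0 : ℝ) < Real.log 2 := Real.log_pos (by norm_num)
  have e : Real.exp (-(Real.log 2 / b * b)) = 1 / 2 := by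
    rw [div_mul_cancel₀ _ hb.ne', Real.exp_neg, Real.exp_log (by norm_num)]
    norm_num
  have e' : Real.exp (-(Real.log 2 / b * b)) ≤ Real.exp (-(Real.log 2 / b * a)) :=
    Real.exp_le_exp.2 (neg_le_neg (mul_le_mul_of_nonneg_left hab (by positivity)))
  linarith

/-- With `L = log (b / a)`, the claim is `exp (-(L / 2) e^{-L}) + exp (-(L / 2)) ≥ 1`. -/
theorem one_le_exp_add_exp_of_log_sub_log {a b : ℝ} (ha : 0 < a) (hab : a ≤ b) :
    1 ≤ Real.exp (-((Real.log b - Real.log a) / (2 * b) * a)) +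
      Real.exp (-((Real.log b - Real.log a) / (2 * b) * b)) := by
  have hb : 0 < b := ha.trans_le hab
  set L := Real.log b - Real.log a with hL
  have hL0 : 0 ≤ L := sub_nonneg.2 (Real.log_le_log ha hab)
  have hr : Real.exp (-L) = a / b := by
    rw [hL, neg_sub, Real.exp_sub, Real.exp_log ha, Real.exp_log hb]
  have e1 : L / (2 * b) * a = L / 2 * Real.exp (-L) := by rw [hr]; field_simp
  have e2 : L / (2 * b) * b = L / 2 := by field_simp
  rw [e1, e2]
  have h1 := Real.add_one_le_exp (-(L / 2 * Real.exp (-L)))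
  have h2 : L / 2 * Real.exp (-L) ≤ Real.exp (-(L / 2)) := by
    have e3 : Real.exp (-L) = Real.exp (-(L / 2)) * Real.exp (-(L / 2)) := by
      rw [← Real.exp_add]
      congr 1
      ring
    have h3 : L / 2 * Real.exp (-(L / 2)) ≤ 1 := by
      have := Real.add_one_le_exp (L / 2)
      have h4 := mul_le_mul_of_nonneg_right (show L / 2 ≤ Real.exp (L / 2) by linarith)
        (Real.exp_pos (-(L / 2))).le
      rwa [← Real.exp_add, add_neg_cancel, Real.exp_zero] at h4
    rw [e3, ← mul_assoc]
    exact mul_le_of_le_one_left (Real.exp_pos _).le h3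
  linarith

end Counting

/-! ### Orbits in the universal cover -/

namespace UniversalCover

open Path

variable {X : Type*}

section

variable [PseudoEMetricSpace X] {x₀ : X}

/-- The deck transformation defined by a loop at the base point. -/
def deckIsometry (c : Homotopic.Quotient x₀ x₀) : UniversalCover x₀ ≃ᵢ UniversalCover x₀ where
  toFun z := ⟨z.proj, c.trans z.cls⟩
  invFun z := ⟨z.proj, c.symm.trans z.cls⟩
  left_inv z := by
    change (⟨z.proj, c.symm.trans (c.trans z.cls)⟩ : UniversalCover x₀) = z
    rw [← Homotopic.Quotient.trans_assoc, Homotopic.Quotient.symm_trans,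
      Homotopic.Quotient.refl_trans]
  right_inv z := by
    change (⟨z.proj, c.trans (c.symm.trans z.cls)⟩ : UniversalCover x₀) = z
    rw [← Homotopic.Quotient.trans_assoc, Homotopic.Quotient.trans_symm,
      Homotopic.Quotient.refl_trans]
  isometry_toFun z z' := by
    change classLength ((c.trans z.cls).symm.trans (c.trans z'.cls)) =
      classLength (z.cls.symm.trans z'.cls)
    rw [Homotopic.Quotient.symm_of_trans, Homotopic.Quotient.trans_assoc,
      ← Homotopic.Quotient.trans_assoc c.symm, Homotopic.Quotient.symm_trans,
      Homotopic.Quotient.refl_trans]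

/-- The loops at the projection of `q` give points of the orbit of `q`. -/
theorem mk_trans_mem_deckOrbit (q : UniversalCover x₀) (d : Homotopic.Quotient q.proj q.proj) :
    (⟨q.proj, q.cls.trans d⟩ : UniversalCover x₀) ∈ deckOrbit q := by
  refine ⟨(deckIsometry ((q.cls.trans d).trans q.cls.symm)).toHomeomorph, fun z => rfl, ?_⟩
  change (⟨q.proj, ((q.cls.trans d).trans q.cls.symm).trans q.cls⟩ : UniversalCover x₀) = _
  rw [Homotopic.Quotient.trans_assoc (q.cls.trans d), Homotopic.Quotient.symm_trans,
    Homotopic.Quotient.trans_refl]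

theorem edist_mk_trans (q : UniversalCover x₀) (d : Homotopic.Quotient q.proj q.proj) :
    edist q ⟨q.proj, q.cls.trans d⟩ = classLength d := by
  change classLength (q.cls.symm.trans (q.cls.trans d)) = _
  rw [← Homotopic.Quotient.trans_assoc, Homotopic.Quotient.symm_trans,
    Homotopic.Quotient.refl_trans]

theorem card_le_orbitCount (q : UniversalCover x₀) {ι : Type*} (s : Finset ι)
    (f : ι → Homotopic.Quotient q.proj q.proj) (hf : Function.Injective f) {R : ℝ}
    (hR : ∀ i ∈ s, classLength (f i) ≤ ENNReal.ofReal R) : (s.card : ℕ∞) ≤ orbitCount q R := by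
  have hinj : Function.Injective fun i => (⟨q.proj, q.cls.trans (f i)⟩ : UniversalCover x₀) := by
    intro i j hij
    have h : q.cls.trans (f i) = q.cls.trans (f j) := by
      simpa using hij
    apply hf
    have h' := congrArg (fun c => q.cls.symm.trans c) h
    simpa only [← Homotopic.Quotient.trans_assoc, Homotopic.Quotient.symm_trans,
      Homotopic.Quotient.refl_trans] using h'
  rw [← Set.encard_coe_eq_coe_finsetCard, ← hinj.injOn.encard_image]
  refine Set.encard_le_encard ?_
  rintro _ ⟨i, hi, rfl⟩
  refine ⟨mk_trans_mem_deckOrbit q (f i), ?_⟩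
  rw [edist_mk_trans]
  exact hR i hi

theorem classLength_wordEval_le {p : X} (α β : Path p p) {a b : ℝ} (ha : 0 ≤ a) (hb : 0 ≤ b)
    (hα : curveLength α ≤ ENNReal.ofReal a) (hβ : curveLength β ≤ ENNReal.ofReal b)
    (w : List Bool) :
    classLength (FundamentalGroup.toPath
      (wordEval (FundamentalGroup.fromPath (Homotopic.Quotient.mk α))
        (FundamentalGroup.fromPath (Homotopic.Quotient.mk β)) w)) ≤
      ENNReal.ofReal (wordLength a b w) := by
  induction w with
  | nil => exact (classLength_refl p).trans_le bot_le
  | cons x w ih =>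
    rw [wordEval_cons, wordLength_cons, add_comm,
      ENNReal.ofReal_add (wordLength_nonneg ha hb w) (by cases x <;> simpa)]
    refine (classLength_trans_le _ _).trans (add_le_add ih ?_)
    cases x
    · exact (classLength_mk_le β).trans hβ
    · exact (classLength_mk_le α).trans hα

/-- The entropy of the cover is at least the growth rate of a free semigroup of loops. -/
theorem le_volumeEntropy {p : X} (q : UniversalCover x₀) (τ : Path q.proj p)
    (hτ : curveLength τ ≠ ⊤) (α β : Path p p)
    (hinj : Function.Injective (wordEval (FundamentalGroup.fromPath (Homotopic.Quotient.mk α))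
      (FundamentalGroup.fromPath (Homotopic.Quotient.mk β)))) {a b h : ℝ} (ha : 0 < a)
    (hab : a ≤ b) (hα : curveLength α ≤ ENNReal.ofReal a) (hβ : curveLength β ≤ ENNReal.ofReal b)
    (hh : 0 ≤ h) (hsum : 1 ≤ Real.exp (-(h * a)) + Real.exp (-(h * b))) :
    (h : EReal) ≤ q.volumeEntropy := by
  set D := (curveLength τ).toReal with hD
  have hD0 : 0 ≤ D := ENNReal.toReal_nonneg
  have hτD : curveLength τ ≤ ENNReal.ofReal D := by rw [hD, ENNReal.ofReal_toReal hτ]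
  let W : List Bool → FundamentalGroup X p :=
    wordEval (FundamentalGroup.fromPath (Homotopic.Quotient.mk α))
      (FundamentalGroup.fromPath (Homotopic.Quotient.mk β))
  let t : Homotopic.Quotient q.proj p := Homotopic.Quotient.mk τ
  let f : List Bool → Homotopic.Quotient q.proj q.proj := fun w =>
    (t.trans (FundamentalGroup.toPath (W w))).trans t.symm
  have hf : Function.Injective f := by
    intro w w' hw
    apply hinj
    have h' := congrArg (fun c => (t.symm.trans c).trans t) hw
    have e : ∀ c : Homotopic.Quotient p p,
        (t.symm.trans ((t.trans c).trans t.symm)).trans t = c := by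
      intro c
      simp only [Homotopic.Quotient.trans_assoc, Homotopic.Quotient.symm_trans,
        Homotopic.Quotient.trans_refl]
      rw [← Homotopic.Quotient.trans_assoc, Homotopic.Quotient.symm_trans,
        Homotopic.Quotient.refl_trans]
    simp only [f, e] at h'
    exact h'
  have hcount : ∀ R : ℝ, 2 * D ≤ R →
      ENNReal.ofReal (Real.exp (h * (R - 2 * D - b))) ≤ ((orbitCount q R : ℕ∞) : ℝ≥0∞) := by
    intro R hR
    obtain ⟨s, hs, hcard⟩ := exists_finset_wordLength_le ha hab hh hsum (R - 2 * D) (by linarith)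
    have h1 : (s.card : ℕ∞) ≤ orbitCount q R := by
      refine card_le_orbitCount q s f hf fun w hw => ?_
      have hw' : classLength (f w) ≤
          ENNReal.ofReal D + ENNReal.ofReal (wordLength a b w) + ENNReal.ofReal D := by
        refine (classLength_trans_le _ _).trans (add_le_add ((classLength_trans_le _ _).trans
          (add_le_add ((classLength_mk_le τ).trans hτD) ?_)) ?_)
        · exact classLength_wordEval_le α β ha.le (ha.le.trans hab) hα hβ w
        · exact (classLength_symm_le _).trans ((classLength_mk_le τ).trans hτD)
      refine hw'.trans ?_
      have hw0 := wordLength_nonneg ha.le (ha.le.trans hab) w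
      rw [← ENNReal.ofReal_add hD0 hw0, ← ENNReal.ofReal_add (by linarith) hD0]
      exact ENNReal.ofReal_le_ofReal (by linarith [hs w hw])
    calc ENNReal.ofReal (Real.exp (h * (R - 2 * D - b))) ≤ ENNReal.ofReal s.card :=
          ENNReal.ofReal_le_ofReal hcard
      _ = ((s.card : ℕ∞) : ℝ≥0∞) := by rw [ENNReal.ofReal_natCast]; rfl
      _ ≤ _ := ENat.toENNReal_le.2 h1
  have hlim : Tendsto (fun R : ℝ => ((h * (R - 2 * D - b) / R : ℝ) : EReal)) atTop
      (𝓝 (h : EReal)) := by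
    refine (continuous_coe_real_ereal.tendsto h).comp ?_
    have h1 : Tendsto (fun R : ℝ => h - h * (2 * D + b) * R⁻¹) atTop
        (𝓝 (h - h * (2 * D + b) * 0)) :=
      tendsto_const_nhds.sub (tendsto_inv_atTop_zero.const_mul _)
    rw [mul_zero, sub_zero] at h1
    refine h1.congr' ?_
    filter_upwards [eventually_gt_atTop 0] with R hR
    field_simp
    ring
  rw [← hlim.limsup_eq]
  refine Filter.limsup_le_limsup ?_
  filter_upwards [eventually_ge_atTop (2 * D), eventually_gt_atTop 0] with R hR hR0
  rw [EReal.coe_div]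
  refine EReal.div_le_div_right_of_nonneg (by exact_mod_cast hR0.le) ?_
  have := ENNReal.log_le_log (hcount R hR)
  rwa [ENNReal.log_ofReal_of_pos (Real.exp_pos _), Real.log_exp] at this

end

end UniversalCover

end

theorem curveLength_eq_zero {X : Type*} [MetricSpace X] {p : X} {γ : Path p p}
    (h : curveLength γ = 0) : γ = Path.refl p := by
  ext t
  have h1 := eVariationOn.edist_le (fun t : I => γ t) (mem_univ t) (mem_univ (0 : I))
  have h2 : edist (γ t) (γ 0) ≤ 0 := h1.trans h.le
  rw [γ.source] at h2
  exact edist_le_zero.1 h2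

theorem mainTheorem6 {X : Type*} [MetricSpace X] (S : FlatSurface X)
    (g : ℕ) (hg : 2 ≤ g) (hX : IsClosedSurfaceOfGenus X g)
    (p : X) (α β : Path p p)
    (hαβ : curveLength α ≤ curveLength β) (hβ : curveLength β ≠ ⊤)
    (hcyc : ¬ IsCyclic (Subgroup.closure
      {FundamentalGroup.fromPath (Path.Homotopic.Quotient.mk α),
        FundamentalGroup.fromPath (Path.Homotopic.Quotient.mk β)}))
    (hbot : Subgroup.closure
      {FundamentalGroup.fromPath (Path.Homotopic.Quotient.mk α),
        FundamentalGroup.fromPath (Path.Homotopic.Quotient.mk β)} ≠ ⊥)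
    (x₀ : X) (q : UniversalCover x₀) :
    ((max
        ((Real.log (curveLength β).toReal - Real.log (curveLength α).toReal) /
          (2 * (curveLength β).toReal))
        (Real.log 2 / (curveLength β).toReal) : ℝ) : EReal)
      ≤ q.volumeEntropy := by
  have hncyc : ¬ ∃ c, FundamentalGroup.fromPath (Path.Homotopic.Quotient.mk α) ∈
      Subgroup.zpowers c ∧ FundamentalGroup.fromPath (Path.Homotopic.Quotient.mk β) ∈
        Subgroup.zpowers c := by
    rintro ⟨c, h1, h2⟩
    have hle : Subgroup.closure {FundamentalGroup.fromPath (Path.Homotopic.Quotient.mk α),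
        FundamentalGroup.fromPath (Path.Homotopic.Quotient.mk β)} ≤ Subgroup.zpowers c := by
      rw [Subgroup.closure_le]
      rintro x (rfl | rfl)
      · exact h1
      · exact h2
    exact hcyc (Subgroup.isCyclic_of_le hle)
  have hinj := (S.mem_zpowers_or_wordEval_injective hg hX _ _).resolve_left hncyc
  have hα : curveLength α ≠ ⊤ := ne_top_of_le_ne_top hβ hαβ
  -- If `α` were constant, the subgroup would be generated by the class of `β`.
  have hα0 : curveLength α ≠ 0 := by
    intro h
    refine hncyc ⟨_, ?_, Subgroup.mem_zpowers _⟩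
    rw [curveLength_eq_zero h]
    exact one_mem _
  have ha : 0 < (curveLength α).toReal := ENNReal.toReal_pos hα0 hα
  have hab : (curveLength α).toReal ≤ (curveLength β).toReal := ENNReal.toReal_mono hβ hαβ
  obtain ⟨τ, hτ⟩ : ∃ τ : Path q.proj p, curveLength τ < ⊤ := by
    have h := edist_lt_top q.proj p
    rw [S.length_metric] at h
    exact iInf_lt_iff.1 h
  have key : ∀ h : ℝ, 0 ≤ h → 1 ≤ Real.exp (-(h * (curveLength α).toReal)) +
      Real.exp (-(h * (curveLength β).toReal)) → (h : EReal) ≤ q.volumeEntropy :=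
    fun h h0 h1 => q.le_volumeEntropy τ hτ.ne α β hinj ha hab (ENNReal.ofReal_toReal hα).ge
      (ENNReal.ofReal_toReal hβ).ge h0 h1
  rcases max_choice ((Real.log (curveLength β).toReal - Real.log (curveLength α).toReal) /
    (2 * (curveLength β).toReal)) (Real.log 2 / (curveLength β).toReal) with h | h <;> rw [h]
  · exact key _ (div_nonneg (sub_nonneg.2 (Real.log_le_log ha hab)) (by linarith))
      (one_le_exp_add_exp_of_log_sub_log ha hab)
  · exact key _ (div_nonneg (Real.log_nonneg (by norm_num)) (by linarith))
      (one_le_exp_add_exp_of_log_two ha hab)
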